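/- Let $G$ be a finite abelian group with dual group $\widehat G$ (the homomorphisms $G\to\mathbb{C}^\times$). A Bohr set $B=\mathrm{Bohr}(\Gamma,\rho)$ is given by a set $\Gamma\subset\widehat G$ and a radius $\rho\ge 0$; its underlying set is $\{x\in G: |\gamma(x)-1|\le\rho \text{ for all }\gamma\in\Gamma\}$, its rank is $\mathrm{rk}(B)=|\Gamma|$, and $B_\tau=\mathrm{Bohr}(\Gamma,\tau\rho)$. Write $\mathrm{Bohr}(\Lambda,\delta)\le\mathrm{Bohr}(\Gamma,\rho)$ if $\Lambda\supset\Gamma$ and $\delta\le\rho$. A Bohr set $B$ of rank $d$ is regular if $1-12d|\tau|\le |B_{1+\tau}|/|B|\le 1+12d|\tau|$ whenever $12d|\tau|\le 1$. If $|G|$ is odd, let $2\cdot B=\mathrm{Bohr}(\Gamma^{1/2},\rho)$, where $\Gamma^{1/2}=\{\chi\in\widehat G:\chi^2\in\Gamma\}$. For $A,A',A''\subset G$ let $2\cdot A=\{2x:x\in A\}$ and let $T(A,A',A'')$ be the number of $(x,y,z)\in A\times A'\times A''$ with $x+z=2y$. Let $1_A*\mu_T(x)=|T|^{-1}\sum_{t\in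 T}1_A(x-t)$ and $\|f\|_\infty=\max_{x\in G}|f(x)|$. There are absolute constants $c,C>0$ such that the following holds. Let $G$ be a finite abelian group of odd order, let $B$ be a regular Bohr set in $G$, and let $B'\le 2\cdot B$ be a regular Bohr set of rank $d$ and radius $\rho$ with $B'\subset B_{c/\mathrm{rk}(B)}$ as sets (if $\mathrm{rk}(B)=0$ this last condition is void). Let $\alpha>0$, and let $A\subset B$ and $A'\subset G$ with $2\cdot A'\subset B'$ satisfy $|A|\ge\alpha|B|$ and $|2\cdot A'|\ge\alpha|B'|$. Then either 1. $T(A,A',A)\ge\tfrac14\alpha|A||A'|$, or 2. there is a regular Bohr set $T\le B'$ of rank at most $d+C\alpha^{-1}\log(2/\alpha)^4$ and radius at least $c\,\min(\rho,2)\,\alpha^{C\log(2/\alpha)}/\max(d,1)^3$ such that $\|1_A*\mu_T\|_\infty\ge\tfrac32\alpha$. -/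

import Mathlib

noncomputable section

open scoped Classical in
/-- The set `{x ∈ G : |γ(x) - 1| ≤ ρ for all γ ∈ Γ}`. -/
def bohrFinset {G : Type*} [AddCommGroup G] [Fintype G]
    (Γ : Finset (AddChar G ℂ)) (ρ : ℝ) : Finset G :=
  Finset.univ.filter fun x => ∀ γ ∈ Γ, ‖γ x - 1‖ ≤ ρ

/-- A Bohr set, given by its defining data: a set of characters and a radius `ρ ≥ 0`. -/
structure BohrSet (G : Type*) [AddCommGroup G] [Fintype G] where
  /-- the set `Γ` of characters -/
  chars : Finset (AddChar G ℂ)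
  /-- the radius `ρ` -/
  radius : ℝ
  radius_nonneg : 0 ≤ radius

namespace BohrSet

variable {G : Type*} [AddCommGroup G] [Fintype G]

/-- The rank `|Γ|`. -/
def rank (B : BohrSet G) : ℕ := B.chars.card

/-- The underlying subset of `G`. -/
def toFinset (B : BohrSet G) : Finset G := bohrFinset B.chars B.radius

/-- The underlying set of the narrowed (or widened) Bohr set `B_τ`. -/
def scaled (B : BohrSet G) (τ : ℝ) : Finset G := bohrFinset B.chars (τ * B.radius)

/-- `B' ≤ B`: `B'` is a sub-Bohr set of `B`. -/
def IsSubBohr (B' B : BohrSet G) : Prop :=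
  B.chars ⊆ B'.chars ∧ B'.radius ≤ B.radius

/-- Regularity: `|B_{1+τ}| / |B|` is within `12d|τ|` of `1` whenever `12d|τ| ≤ 1`, where `d` is the
rank. (In rank `0` both sets are all of `G`, and the condition holds.) -/
def IsRegular (B : BohrSet G) : Prop :=
  ∀ τ : ℝ, 12 * (B.rank : ℝ) * |τ| ≤ 1 →
    1 - 12 * (B.rank : ℝ) * |τ| ≤ ((B.scaled (1 + τ)).card : ℝ) / (B.toFinset.card : ℝ) ∧
      ((B.scaled (1 + τ)).card : ℝ) / (B.toFinset.card : ℝ) ≤ 1 + 12 * (B.rank : ℝ) * |τ|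

open scoped Classical in
/-- The Bohr set `2 · B` with characters `Γ^{1/2}` and the same radius. When `G` has odd order,
squaring is a bijection of the dual group, so `Γ^{1/2}` is the set of `χ` with `χ ^ 2 ∈ Γ`. -/
def two (B : BohrSet G) : BohrSet G where
  chars := Finset.univ.filter fun χ => χ ^ 2 ∈ B.chars
  radius := B.radius
  radius_nonneg := B.radius_nonneg

end BohrSet

open scoped Classical in
/-- `2 · A = {2x : x ∈ A}`. -/
def twoDilate {G : Type*} [AddCommGroup G] (A : Finset G) : Finset G :=
  A.image fun x => 2 • x

/-- The relative density `|A| / |B|` of `A` in `B`. -/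
def relDensity {G : Type*} (A B : Finset G) : ℝ := (A.card : ℝ) / (B.card : ℝ)

open scoped Classical in
/-- The number `T(A, B, C)` of triples `(x, y, z) ∈ A × B × C` with `x + z = 2y`. -/
def threeAPCount {G : Type*} [AddCommGroup G] (A B C : Finset G) : ℕ :=
  ((A ×ˢ B ×ˢ C).filter fun p => p.1 + p.2.2 = 2 • p.2.1).card

/-- The indicator function `1_A`. -/
def indicatorFn {G : Type*} (A : Finset G) : G → ℝ :=
  Set.indicator (A : Set G) fun _ => 1

/-- The function `μ_A = 1_A / |A|`. -/
def muFn {G : Type*} (A : Finset G) : G → ℝ :=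
  fun x => indicatorFn A x / (A.card : ℝ)

/-- Convolution `f * g (x) = ∑ y, f y * g (x - y)`. -/
def conv {G : Type*} [AddCommGroup G] [Fintype G] (f g : G → ℝ) : G → ℝ :=
  fun x => ∑ y, f y * g (x - y)

/-- The supremum norm `sup_x |f x|` on a finite set. -/
def supNorm {G : Type*} [Fintype G] (f : G → ℝ) : ℝ := ⨆ x, |f x|

end

/-! Put `E = -(2 • A')` and `h = 1_A * μ_E`. As `|G|` is odd, `T(A, A', A) = |A'| ∑_{x ∈ A} h(-x)`,
so `h` must be shown to average at least `α/4` over `-A` unless some `1_A * μ_T` reaches `3α/2`.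

Almost-periods (`exists_almostPeriods`, the Croot–Sisask argument): `h` is approximated by the mean
of `m` random translates of `1_A`, with `ℓ^{2p}` error at most a multiple of `θ ‖h + α‖`. The error
is relative to `h + α`, so `m` of order `p θ⁻² α⁻¹` suffices; an absolute error `θα` would cost
`α⁻²`. Pigeonholing gives a set `X`, of relative density about `(α/2)^m` in a small Bohr set `S`,
whose differences are almost-periods of `h`.

Smoothing: convolving `h` with `k` copies of `μ_X * μ_{-X}` gives `h_k`, which moves `h` by `O(kθ ‖h
+ α‖)` and makes the frequencies with `|ft μ_X| < 1/2` negligible. By Chang's theorem relative to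
`S` (`exists_annihilator`) the other frequencies are controlled by `N`, about `m log(2/α)`, new
characters. Adding these to `B'` gives `T`, and `h_k` is uniformly almost invariant under `T`
(`abs_conv_smoothKernel_translate_sub_le`). With `p` and `k` of order `log(2/α)` and `θ = 1/(100k)`,
`N` has order `α⁻¹ log(2/α)^4`.

Conclusion (`le_sum_conv_of_forall_le`): suppose that `f = 1_A * μ_T` is at most `M = 3α/2`
everywhere. Then `h_k ≤ 2α`, which bounds `‖h + α‖`, and Hölder makes the pairing of `h - h_k` with
`1_{-A}` at most `α|A|/4`. The pairing of `h_k * μ_T * μ_T` with `1_{-A}` is an average of values of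
`f * f` near `0`. As `f ≤ M` and `f` has mass `|A| ≥ α|B|` essentially on `B`, these are at least
about `M(2|A| - M|B|) ≥ 3α|A|/4`; what matters is `M < 2α`. -/

noncomputable section

open Finset

/-! ### Convolution, probability measures and indicator functions. -/

section Convolution

variable {G : Type*} [AddCommGroup G] [Fintype G]

/-- A probability mass function on a finite type, as a real function. -/
def IsProb {G : Type*} [Fintype G] (μ : G → ℝ) : Prop := (∀ x, 0 ≤ μ x) ∧ ∑ x, μ x = 1

lemma conv_comm (f g : G → ℝ) : conv f g = conv g f := by
  funext x
  unfold conv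
  rw [← Equiv.sum_comp (Equiv.subLeft x)]
  simp [mul_comm]

lemma conv_apply' (f g : G → ℝ) (x : G) : conv f g x = ∑ y, g y * f (x - y) := by
  rw [conv_comm]; rfl

lemma conv_assoc (f g h : G → ℝ) : conv (conv f g) h = conv f (conv g h) := by
  funext x
  simp only [conv, sum_mul, mul_sum]
  rw [sum_comm]
  refine sum_congr rfl fun y _ => ?_
  rw [← Equiv.sum_comp (Equiv.addRight y)]
  refine sum_congr rfl fun z _ => ?_
  simp only [Equiv.coe_addRight, add_sub_cancel_right]
  rw [sub_add_eq_sub_sub_swap, mul_assoc]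

lemma conv_right_comm (f g h : G → ℝ) : conv (conv f g) h = conv (conv f h) g := by
  rw [conv_assoc, conv_comm g h, conv_assoc]

lemma sum_conv (f g : G → ℝ) : ∑ x, conv f g x = (∑ x, f x) * ∑ x, g x := by
  simp only [conv]
  rw [sum_comm, sum_mul]
  refine sum_congr rfl fun y _ => ?_
  rw [← mul_sum]
  congr 1
  exact (Equiv.subRight y).sum_comp g

lemma conv_nonneg {f g : G → ℝ} (hf : ∀ x, 0 ≤ f x) (hg : ∀ x, 0 ≤ g x) (x : G) :
    0 ≤ conv f g x :=
  sum_nonneg fun _ _ => mul_nonneg (hf _) (hg _)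

lemma IsProb.conv {μ ν : G → ℝ} (hμ : IsProb μ) (hν : IsProb ν) : IsProb (conv μ ν) :=
  ⟨conv_nonneg hμ.1 hν.1, by rw [sum_conv, hμ.2, hν.2, mul_one]⟩

lemma conv_le_of_le {f μ : G → ℝ} {M : ℝ} (hμ : IsProb μ) (hf : ∀ x, f x ≤ M) (x : G) :
    conv f μ x ≤ M := by
  rw [conv_apply']
  calc ∑ y, μ y * f (x - y) ≤ ∑ y, μ y * M :=
        sum_le_sum fun y _ => mul_le_mul_of_nonneg_left (hf _) (hμ.1 y)
    _ = M := by rw [← sum_mul, hμ.2, one_mul]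

lemma conv_ne_zero {f g : G → ℝ} {x : G} (h : conv f g x ≠ 0) :
    ∃ y z, f y ≠ 0 ∧ g z ≠ 0 ∧ y + z = x := by
  obtain ⟨y, -, hy⟩ := exists_ne_zero_of_sum_ne_zero h
  exact ⟨y, x - y, left_ne_zero_of_mul hy, right_ne_zero_of_mul hy, by abel⟩

/-- If translating `f` by the points of the support of `μ` moves its values by at most `η`, then so
does averaging over `μ`. -/
lemma abs_conv_sub_le {f μ : G → ℝ} {η : ℝ} (hμ : IsProb μ)
    (hf : ∀ x y, μ y ≠ 0 → |f (x - y) - f x| ≤ η) (x : G) : |conv f μ x - f x| ≤ η := by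
  have h1 : conv f μ x - f x = ∑ y, μ y * (f (x - y) - f x) := by
    simp only [mul_sub, sum_sub_distrib, ← sum_mul, hμ.2, one_mul, conv_apply']
  rw [h1]
  calc |∑ y, μ y * (f (x - y) - f x)| ≤ ∑ y, |μ y * (f (x - y) - f x)| := abs_sum_le_sum_abs _ _
    _ ≤ ∑ y, μ y * η := by
        refine sum_le_sum fun y _ => ?_
        rw [abs_mul, abs_of_nonneg (hμ.1 y)]
        by_cases h : μ y = 0
        · simp [h]
        · exact mul_le_mul_of_nonneg_left (hf x y h) (hμ.1 y)
    _ = η := by rw [← sum_mul, hμ.2, one_mul]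

lemma indicatorFn_nonneg {G : Type*} (A : Finset G) (x : G) : 0 ≤ indicatorFn A x :=
  Set.indicator_nonneg (fun _ _ => zero_le_one) x

lemma indicatorFn_of_mem {G : Type*} {A : Finset G} {x : G} (h : x ∈ A) : indicatorFn A x = 1 :=
  Set.indicator_of_mem (by exact_mod_cast h) _

lemma indicatorFn_of_notMem {G : Type*} {A : Finset G} {x : G} (h : x ∉ A) :
    indicatorFn A x = 0 :=
  Set.indicator_of_notMem (by exact_mod_cast h) _

lemma mem_of_indicatorFn_ne_zero {G : Type*} {A : Finset G} {x : G} (h : indicatorFn A x ≠ 0) :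
    x ∈ A := by
  by_contra h'
  exact h (indicatorFn_of_notMem h')

lemma indicatorFn_le_one {G : Type*} (A : Finset G) (x : G) : indicatorFn A x ≤ 1 := by
  by_cases h : x ∈ A
  · rw [indicatorFn_of_mem h]
  · rw [indicatorFn_of_notMem h]; exact zero_le_one

lemma sum_indicatorFn_mul {G : Type*} [Fintype G] (A : Finset G) (f : G → ℝ) :
    ∑ x, indicatorFn A x * f x = ∑ x ∈ A, f x := by
  rw [← sum_subset (subset_univ A)]
  · exact sum_congr rfl fun x hx => by rw [indicatorFn_of_mem hx, one_mul]
  · intro x _ hx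
    rw [indicatorFn_of_notMem hx, zero_mul]

lemma sum_indicatorFn {G : Type*} [Fintype G] (A : Finset G) :
    ∑ x, indicatorFn A x = (A.card : ℝ) := by
  have := sum_indicatorFn_mul A fun _ => 1
  simpa using this

lemma sum_muFn_mul {G : Type*} [Fintype G] (A : Finset G) (f : G → ℝ) :
    ∑ x, muFn A x * f x = (∑ x ∈ A, f x) / A.card := by
  rw [← sum_indicatorFn_mul A f, sum_div]
  exact sum_congr rfl fun x _ => by rw [muFn]; ring

lemma isProb_muFn {G : Type*} [Fintype G] {A : Finset G} (hA : A.Nonempty) : IsProb (muFn A) := by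
  refine ⟨fun x => div_nonneg (indicatorFn_nonneg A x) (Nat.cast_nonneg _), ?_⟩
  have := sum_muFn_mul A fun _ => 1
  simp only [mul_one, sum_const, nsmul_eq_mul] at this
  rw [this, div_self]
  exact_mod_cast hA.card_pos.ne'

lemma mem_of_muFn_ne_zero {G : Type*} {A : Finset G} {x : G} (h : muFn A x ≠ 0) : x ∈ A := by
  refine mem_of_indicatorFn_ne_zero fun h' => h ?_
  rw [muFn, h', zero_div]

lemma conv_indicatorFn_muFn (A E : Finset G) (x : G) :
    conv (indicatorFn A) (muFn E) x = (∑ y ∈ E, indicatorFn A (x - y)) / E.card := by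
  rw [conv_apply', sum_muFn_mul E fun y => indicatorFn A (x - y)]

end Convolution

/-! ### The Fourier transform on a finite abelian group. -/

section Fourier

variable {G : Type*} [AddCommGroup G] [Fintype G]

/-- The Fourier transform `∑ x, f x γ(x)` of a real function. -/
def ft (f : G → ℝ) (γ : AddChar G ℂ) : ℂ := ∑ x, (f x : ℂ) * γ x

lemma ft_conv (f g : G → ℝ) (γ : AddChar G ℂ) : ft (conv f g) γ = ft f γ * ft g γ := by
  simp only [ft, conv, Complex.ofReal_sum, sum_mul, Complex.ofReal_mul]
  rw [sum_comm]
  refine sum_congr rfl fun y _ => ?_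
  rw [← Equiv.sum_comp (Equiv.addRight y), mul_sum]
  refine sum_congr rfl fun z _ => ?_
  simp only [Equiv.coe_addRight, add_sub_cancel_right, AddChar.map_add_eq_mul]
  ring

lemma ft_translate (f : G → ℝ) (t : G) (γ : AddChar G ℂ) :
    ft (fun x => f (x - t)) γ = γ t * ft f γ := by
  simp only [ft, mul_sum]
  rw [← Equiv.sum_comp (Equiv.addRight t)]
  refine sum_congr rfl fun z _ => ?_
  simp only [Equiv.coe_addRight, add_sub_cancel_right, AddChar.map_add_eq_mul]
  ring

lemma ft_sub (f g : G → ℝ) (γ : AddChar G ℂ) :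
    ft (fun x => f x - g x) γ = ft f γ - ft g γ := by
  simp [ft, sub_mul]

lemma norm_ft_le_one {μ : G → ℝ} (hμ : IsProb μ) (γ : AddChar G ℂ) : ‖ft μ γ‖ ≤ 1 := by
  refine (norm_sum_le _ _).trans ?_
  rw [← hμ.2]
  refine (sum_congr rfl fun x _ => ?_).le
  rw [norm_mul, AddChar.norm_apply, mul_one, Complex.norm_real, Real.norm_eq_abs,
    abs_of_nonneg (hμ.1 x)]

lemma norm_ft_neg (μ : G → ℝ) (γ : AddChar G ℂ) : ‖ft (fun x => μ (-x)) γ‖ = ‖ft μ γ‖ := by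
  rw [← RCLike.norm_conj (ft μ γ)]
  congr 1
  simp only [ft, map_sum, map_mul, Complex.conj_ofReal, ← AddChar.map_neg_eq_conj]
  rw [← Equiv.sum_comp (Equiv.neg G)]
  simp

/-- Parseval's identity. -/
lemma sum_norm_ft_sq (f : G → ℝ) :
    ∑ γ : AddChar G ℂ, ‖ft f γ‖ ^ 2 = Fintype.card G * ∑ x, f x ^ 2 := by
  classical
  have h1 : ∀ γ : AddChar G ℂ, ((‖ft f γ‖ ^ 2 : ℝ) : ℂ)
      = ∑ x, ∑ y, (f x : ℂ) * f y * γ (x - y) := by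
    intro γ
    rw [Complex.ofReal_pow, ← Complex.mul_conj', ft, map_sum, sum_mul_sum]
    refine sum_congr rfl fun x _ => sum_congr rfl fun y _ => ?_
    rw [map_mul, Complex.conj_ofReal, ← AddChar.map_neg_eq_conj, sub_eq_add_neg,
      AddChar.map_add_eq_mul]
    ring
  have h2 : ((∑ γ : AddChar G ℂ, ‖ft f γ‖ ^ 2 : ℝ) : ℂ)
      = ((Fintype.card G * ∑ x, f x ^ 2 : ℝ) : ℂ) := by
    rw [Complex.ofReal_sum]
    simp_rw [h1]
    rw [sum_comm]
    push_cast
    rw [mul_sum]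
    refine sum_congr rfl fun x _ => ?_
    rw [sum_comm]
    simp_rw [← mul_sum, AddChar.sum_apply_eq_ite, sub_eq_zero]
    simp
    ring
  exact_mod_cast h2

end Fourier

/-! ### `ℓ^n` norms and iterated convolution. -/

section EllNorm

variable {G : Type*} [Fintype G]

/-- The `ℓ^n` norm of a real function on a finite type. -/
def ellNorm (n : ℕ) (f : G → ℝ) : ℝ := (∑ x, |f x| ^ n) ^ ((1 : ℝ) / n)

variable {n : ℕ}

lemma sum_abs_pow_nonneg (f : G → ℝ) : 0 ≤ ∑ x, |f x| ^ n :=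
  sum_nonneg fun _ _ => pow_nonneg (abs_nonneg _) _

lemma ellNorm_nonneg (f : G → ℝ) : 0 ≤ ellNorm n f := Real.rpow_nonneg (sum_abs_pow_nonneg f) _

lemma ellNorm_pow (hn : n ≠ 0) (f : G → ℝ) : ellNorm n f ^ n = ∑ x, |f x| ^ n := by
  rw [ellNorm, one_div, Real.rpow_inv_natCast_pow (sum_abs_pow_nonneg f) hn]

lemma ellNorm_le_iff (hn : n ≠ 0) {f : G → ℝ} {b : ℝ} (hb : 0 ≤ b) :
    ellNorm n f ≤ b ↔ ∑ x, |f x| ^ n ≤ b ^ n := by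
  rw [← ellNorm_pow hn, pow_le_pow_iff_left₀ (ellNorm_nonneg f) hb hn]

lemma ellNorm_add_le (hn : n ≠ 0) (f g : G → ℝ) :
    ellNorm n (fun x => f x + g x) ≤ ellNorm n f + ellNorm n g := by
  have := Real.Lp_add_le univ f g (p := n) (by exact_mod_cast Nat.one_le_iff_ne_zero.2 hn)
  simpa only [ellNorm, Real.rpow_natCast] using this

lemma ellNorm_smul (hn : n ≠ 0) (c : ℝ) (f : G → ℝ) :
    ellNorm n (fun x => c * f x) = |c| * ellNorm n f := by
  rw [← pow_left_inj₀ (ellNorm_nonneg _) (mul_nonneg (abs_nonneg _) (ellNorm_nonneg _)) hn,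
    mul_pow, ellNorm_pow hn, ellNorm_pow hn, mul_sum]
  simp [abs_mul, mul_pow]

lemma ellNorm_neg (f : G → ℝ) : ellNorm n (fun x => -f x) = ellNorm n f := by
  simp [ellNorm]

lemma ellNorm_mono (hn : n ≠ 0) {f g : G → ℝ} (h : ∀ x, |f x| ≤ |g x|) :
    ellNorm n f ≤ ellNorm n g := by
  rw [ellNorm_le_iff hn (ellNorm_nonneg g), ellNorm_pow hn]
  exact sum_le_sum fun x _ => pow_le_pow_left₀ (abs_nonneg _) (h x) n

lemma ellNorm_sum_le {ι : Type*} (hn : n ≠ 0) (s : Finset ι) (f : ι → G → ℝ) :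
    ellNorm n (fun x => ∑ i ∈ s, f i x) ≤ ∑ i ∈ s, ellNorm n (f i) := by
  classical
  induction s using Finset.induction_on with
  | empty => simp [ellNorm, hn]
  | insert a s ha ih =>
    simp only [sum_insert ha]
    exact (ellNorm_add_le hn _ _).trans (by gcongr)

lemma ellNorm_translate {G : Type*} [AddCommGroup G] [Fintype G] (f : G → ℝ) (t : G) :
    ellNorm n (fun x => f (x - t)) = ellNorm n f := by
  unfold ellNorm
  congr 1
  exact (Equiv.subRight t).sum_comp fun x => |f x| ^ n

/-- A weighted average has norm at most a common bound on the norms. -/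
lemma ellNorm_average_le {ι : Type*} [Fintype ι] (hn : n ≠ 0) {μ : ι → ℝ} (hμ : IsProb μ)
    (f : ι → G → ℝ) {η : ℝ} (hf : ∀ i, μ i ≠ 0 → ellNorm n (f i) ≤ η) :
    ellNorm n (fun x => ∑ i, μ i * f i x) ≤ η := by
  refine (ellNorm_sum_le hn univ fun i x => μ i * f i x).trans ?_
  calc ∑ i, ellNorm n (fun x => μ i * f i x) ≤ ∑ i, μ i * η := by
        refine sum_le_sum fun i _ => ?_
        rw [ellNorm_smul hn, abs_of_nonneg (hμ.1 i)]
        by_cases h : μ i = 0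
        · simp [h]
        · exact mul_le_mul_of_nonneg_left (hf i h) (hμ.1 i)
    _ = η := by rw [← sum_mul, hμ.2, one_mul]

variable {G : Type*} [AddCommGroup G] [Fintype G]

lemma ellNorm_conv_le (hn : n ≠ 0) {μ : G → ℝ} (hμ : IsProb μ) (f : G → ℝ) :
    ellNorm n (conv f μ) ≤ ellNorm n f := by
  have : conv f μ = fun x => ∑ y, μ y * f (x - y) := funext fun x => conv_apply' f μ x
  rw [this]
  exact ellNorm_average_le hn hμ (fun y x => f (x - y)) fun y _ => (ellNorm_translate f y).le

lemma ellNorm_conv_sub_le (hn : n ≠ 0) {μ : G → ℝ} (hμ : IsProb μ) (f : G → ℝ) {η : ℝ}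
    (hf : ∀ y, μ y ≠ 0 → ellNorm n (fun x => f (x - y) - f x) ≤ η) :
    ellNorm n (fun x => conv f μ x - f x) ≤ η := by
  have : (fun x => conv f μ x - f x) = fun x => ∑ y, μ y * (f (x - y) - f x) := by
    funext x
    simp only [mul_sub, sum_sub_distrib, ← sum_mul, hμ.2, one_mul, conv_apply']
  rw [this]
  exact ellNorm_average_le hn hμ (fun y x => f (x - y) - f x) hf

/-- `f * σ * ⋯ * σ` with `k` factors `σ`. -/
def convIter (σ f : G → ℝ) (k : ℕ) : G → ℝ := (fun g => conv g σ)^[k] f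

lemma convIter_zero (σ f : G → ℝ) : convIter σ f 0 = f := rfl

lemma convIter_succ (σ f : G → ℝ) (k : ℕ) :
    convIter σ f (k + 1) = conv (convIter σ f k) σ := Function.iterate_succ_apply' _ _ _

lemma conv_convIter (σ f g : G → ℝ) (k : ℕ) :
    conv g (convIter σ f k) = convIter σ (conv g f) k := by
  induction k with
  | zero => rfl
  | succ k ih => rw [convIter_succ, convIter_succ, ← conv_assoc, ih]

lemma isProb_convIter {σ f : G → ℝ} (hσ : IsProb σ) (hf : IsProb f) (k : ℕ) :
    IsProb (convIter σ f k) := by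
  induction k with
  | zero => exact hf
  | succ k ih => rw [convIter_succ]; exact ih.conv hσ

lemma ft_convIter (σ f : G → ℝ) (k : ℕ) (γ : AddChar G ℂ) :
    ft (convIter σ f k) γ = ft f γ * ft σ γ ^ k := by
  induction k with
  | zero => simp [convIter_zero]
  | succ k ih => rw [convIter_succ, ft_conv, ih, pow_succ, mul_assoc]

/-- Telescoping: convolution with `σ` is a contraction, so each further factor costs at most as much
as the first. -/
lemma ellNorm_convIter_sub_le (hn : n ≠ 0) {σ : G → ℝ} (hσ : IsProb σ) (f : G → ℝ) (k : ℕ) :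
    ellNorm n (fun x => convIter σ f k x - f x)
      ≤ k * ellNorm n (fun x => conv f σ x - f x) := by
  induction k with
  | zero => simp [convIter_zero, ellNorm, hn]
  | succ k ih =>
    have h1 : (fun x => convIter σ f (k + 1) x - f x) = fun x =>
        conv (fun x => convIter σ f k x - f x) σ x + (conv f σ x - f x) := by
      funext x
      have : conv (fun x => convIter σ f k x - f x) σ x
          = conv (convIter σ f k) σ x - conv f σ x := by
        simp [conv, sub_mul]
      rw [this, convIter_succ]
      ring
    rw [h1]
    refine (ellNorm_add_le hn _ _).trans ?_
    have := ellNorm_conv_le hn hσ (fun x => convIter σ f k x - f x)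
    push_cast
    linarith

end EllNorm

/-! ### Arithmetic and covering of Bohr sets. -/

section BohrBasic

variable {G : Type*} [AddCommGroup G] [Fintype G] {Γ Λ : Finset (AddChar G ℂ)} {ρ ρ' : ℝ} {x y : G}

lemma mem_bohrFinset : x ∈ bohrFinset Γ ρ ↔ ∀ γ ∈ Γ, ‖γ x - 1‖ ≤ ρ := by
  classical
  simp [bohrFinset]

lemma zero_mem_bohrFinset (hρ : 0 ≤ ρ) : (0 : G) ∈ bohrFinset Γ ρ := by
  simp [mem_bohrFinset, hρ]

lemma bohrFinset_mono (hΓ : Γ ⊆ Λ) (hρ : ρ ≤ ρ') : bohrFinset Λ ρ ⊆ bohrFinset Γ ρ' :=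
  fun _ hx => mem_bohrFinset.2 fun γ hγ => (mem_bohrFinset.1 hx γ (hΓ hγ)).trans hρ

lemma norm_char_sub (γ : AddChar G ℂ) (x y : G) : ‖γ (x - y) - 1‖ = ‖γ x - γ y‖ := by
  have : γ x - γ y = (γ (x - y) - 1) * γ y := by
    rw [sub_mul, ← AddChar.map_add_eq_mul, sub_add_cancel, one_mul]
  rw [this, norm_mul, AddChar.norm_apply, mul_one]

lemma norm_char_add_sub_one_le (γ : AddChar G ℂ) (x y : G) :
    ‖γ (x + y) - 1‖ ≤ ‖γ x - 1‖ + ‖γ y - 1‖ := by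
  have : γ (x + y) - 1 = (γ x - 1) * γ y + (γ y - 1) := by rw [AddChar.map_add_eq_mul]; ring
  rw [this]
  refine (norm_add_le _ _).trans ?_
  rw [norm_mul, AddChar.norm_apply, mul_one]

lemma norm_char_neg_sub_one (γ : AddChar G ℂ) (x : G) : ‖γ (-x) - 1‖ = ‖γ x - 1‖ := by
  rw [← zero_sub, norm_char_sub, AddChar.map_zero_eq_one, norm_sub_rev]

lemma neg_mem_bohrFinset (hx : x ∈ bohrFinset Γ ρ) : -x ∈ bohrFinset Γ ρ :=
  mem_bohrFinset.2 fun γ hγ => (norm_char_neg_sub_one γ x).trans_le (mem_bohrFinset.1 hx γ hγ)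

lemma add_mem_bohrFinset (hx : x ∈ bohrFinset Γ ρ) (hy : y ∈ bohrFinset Γ ρ') :
    x + y ∈ bohrFinset Γ (ρ + ρ') :=
  mem_bohrFinset.2 fun γ hγ => (norm_char_add_sub_one_le γ x y).trans
    (add_le_add (mem_bohrFinset.1 hx γ hγ) (mem_bohrFinset.1 hy γ hγ))

lemma sub_mem_bohrFinset (hx : x ∈ bohrFinset Γ ρ) (hy : y ∈ bohrFinset Γ ρ') :
    x - y ∈ bohrFinset Γ (ρ + ρ') := by
  rw [sub_eq_add_neg]; exact add_mem_bohrFinset hx (neg_mem_bohrFinset hy)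

lemma card_bohrFinset_pos (hρ : 0 ≤ ρ) : 0 < (bohrFinset Γ ρ).card :=
  card_pos.2 ⟨0, zero_mem_bohrFinset hρ⟩

/-- Covering a Bohr set by translates of a Bohr set whose radius is `R` times smaller. -/
lemma card_bohrFinset_le (hρ : 0 < ρ) {R : ℕ} (hR : 0 < R) :
    (bohrFinset Γ ρ).card ≤ (bohrFinset Γ (ρ / R)).card * ((4 * R + 1) ^ 2) ^ Γ.card := by
  classical
  have hR' : (0 : ℝ) < R := by exact_mod_cast hR
  -- The square of values of `γ x - 1` is cut into cells of side `ρ/(2R)`. Two points in the same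
  -- cell for every `γ` differ by an element of radius at most `2 · ρ/(2R) = ρ/R`, and each
  -- coordinate takes at most `4R + 1` integer values.
  set s : ℝ := 2 * R / ρ with hs
  have hs0 : 0 < s := by positivity
  let q : G → (Γ → ℤ × ℤ) := fun x γ => (⌊(γ.1 x - 1).re * s⌋, ⌊(γ.1 x - 1).im * s⌋)
  let I : Finset ℤ := Icc (-(2 * R : ℤ)) (2 * R)
  have hmaps : ∀ x ∈ bohrFinset Γ ρ, q x ∈ Fintype.piFinset fun _ : Γ => I ×ˢ I := by
    intro x hx
    rw [Fintype.mem_piFinset]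
    intro γ
    have hγ := mem_bohrFinset.1 hx γ.1 γ.2
    have key : ∀ t : ℝ, |t| ≤ ρ → ⌊t * s⌋ ∈ I := by
      intro t ht
      have h1 : |t * s| ≤ 2 * R := by
        rw [abs_mul, abs_of_pos hs0]
        calc |t| * s ≤ ρ * s := by gcongr
          _ = 2 * R := by rw [hs]; field_simp
      rw [abs_le] at h1
      rw [Finset.mem_Icc]
      constructor
      · rw [Int.le_floor]; push_cast; exact h1.1
      · have : (⌊t * s⌋ : ℝ) ≤ ((2 * R : ℤ) : ℝ) := by
          push_cast; exact (Int.floor_le _).trans h1.2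
        exact_mod_cast this
    exact mem_product.2 ⟨key _ ((Complex.abs_re_le_norm _).trans hγ),
      key _ ((Complex.abs_im_le_norm _).trans hγ)⟩
  have hcard : (Fintype.piFinset fun _ : Γ => I ×ˢ I).card = ((4 * R + 1) ^ 2) ^ Γ.card := by
    have hI : I.card = 4 * R + 1 := by simp only [I, Int.card_Icc]; omega
    simp [Fintype.card_piFinset, hI, sq]
  rw [← hcard]
  refine card_le_mul_card_image_of_maps_to hmaps _ fun b _ => ?_
  rcases ({a ∈ bohrFinset Γ ρ | q a = b} : Finset G).eq_empty_or_nonempty with h | ⟨x₀, hx₀⟩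
  · rw [h]; simp
  refine card_le_card_of_injOn (fun x => x - x₀) ?_ (fun x _ y _ h => by simpa using h)
  intro x hx
  rw [Finset.mem_coe, mem_filter] at hx
  rw [mem_filter] at hx₀
  refine mem_bohrFinset.2 fun γ hγ => ?_
  have hq := congrFun (hx.2.trans hx₀.2.symm) ⟨γ, hγ⟩
  rw [Prod.mk.injEq] at hq
  have key : ∀ t u : ℝ, ⌊t * s⌋ = ⌊u * s⌋ → |t - u| ≤ ρ / R / 2 := by
    intro t u h
    have h1 := Int.abs_sub_lt_one_of_floor_eq_floor h
    rw [← sub_mul, abs_mul, abs_of_pos hs0] at h1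
    have h2 : |t - u| < 1 / s := by rwa [lt_div_iff₀ hs0]
    refine h2.le.trans (le_of_eq ?_)
    rw [hs]; field_simp
  have h1 := key _ _ hq.1
  have h2 := key _ _ hq.2
  rw [norm_char_sub]
  refine (Complex.norm_le_abs_re_add_abs_im _).trans ?_
  simp only [Complex.sub_re, Complex.sub_im, sub_sub_sub_cancel_right] at h1 h2 ⊢
  linarith

end BohrBasic

/-! ### Existence of regular Bohr sets. -/

section Regular

open MeasureTheory Set in
/-- A monotone function that grows slowly on average has a point at which it is Lipschitz, with
respect to all comparison points within a given distance. -/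
lemma Monotone.exists_lipschitz_point {f : ℝ → ℝ} (hf : Monotone f) {a b s h : ℝ} (hab : a ≤ b) (hh : 0 < h)
    (hs : 0 < s) (hlt : 3.1 * (f (b + 2 * h) - f (a - 2 * h)) < s * (b - a)) :
    ∃ x ∈ Set.Icc a b, ∀ y, |y - x| ≤ h → |f y - f x| ≤ s * |y - x| := by
  -- Otherwise each `x` has a partner `y x` with `f` growing faster than `s` between them. By
  -- Vitali's covering lemma, disjoint such intervals cover `[a, b]` after enlargement, which forces
  -- too much total growth.
  by_contra! hcon
  choose! y hy1 hy2 using hcon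
  set δ : ℝ → ℝ := fun x => |y x - x| with hδ
  have hδ0 : ∀ x ∈ Set.Icc a b, 0 < δ x := by
    intro x hx
    rw [hδ, abs_pos]
    intro h0
    have := hy2 x hx
    rw [h0, sub_eq_zero.1 h0] at this
    simp at this
  obtain ⟨u, hut, hud, huc⟩ := Vitali.exists_disjoint_subfamily_covering_enlargement
    (fun x => uIcc x (y x)) (Set.Icc a b) δ 1.05 (by norm_num) (fun x hx => (hδ0 x hx).le) h
    hy1 (fun x _ => nonempty_uIcc)
  have hucount : u.Countable := by
    refine hud.countable_of_nonempty_interior fun x hx => ?_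
    rw [Set.uIcc, interior_Icc, Set.nonempty_Ioo]
    refine inf_lt_sup.2 fun h0 => ?_
    have := hδ0 x (hut hx)
    rw [hδ] at this
    simp [← h0] at this
  -- An interval of length `δ x` widened by `1.05 δ x` on both sides has length `3.1 δ x`; this is
  -- the constant in `hlt`.
  set J : ℝ → Set ℝ := fun x => Set.Icc (min x (y x) - 1.05 * δ x) (max x (y x) + 1.05 * δ x)
  have hlen : ∀ x, max x (y x) - min x (y x) = δ x := fun x => by
    rw [max_sub_min_eq_abs']; exact abs_sub_comm _ _
  have hcov : Set.Icc a b ⊆ ⋃ x ∈ u, J x := by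
    intro x hx
    obtain ⟨z, hz, ⟨w, hw1, hw2⟩, hle⟩ := huc x hx
    rw [mem_iUnion₂]
    refine ⟨z, hz, ?_⟩
    have h1 : |w - x| ≤ δ x := by
      have := abs_sub_left_of_mem_uIcc hw1
      exact this
    rw [Set.mem_uIcc] at hw2
    have h3 := abs_le.1 (h1.trans hle)
    have h4 : min z (y z) ≤ w := by rcases hw2 with h | h <;> simp [h.1]
    have h5 : w ≤ max z (y z) := by rcases hw2 with h | h <;> simp [h.2]
    constructor <;> linarith [h3.1, h3.2]
  -- As `f` may jump, its growth is measured by the Stieltjes measure of its right limits: a closed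
  -- interval has at least the mass of the increment of `f`. The spare `h` at each end in `f (b + 2
  -- * h)` and `f (a - 2 * h)` absorbs the one-sided limits.
  set m := hf.stieltjesFunction.measure
  have hm : ∀ x ∈ u, ENNReal.ofReal (s * δ x) ≤ m (uIcc x (y x)) := by
    intro x hx
    rw [Set.uIcc, StieltjesFunction.measure_Icc]
    refine ENNReal.ofReal_le_ofReal ?_
    have h1 : f (max x (y x)) ≤ hf.stieltjesFunction (max x (y x)) := hf.le_rightLim le_rfl
    have h2 : Function.leftLim hf.stieltjesFunction (min x (y x)) ≤ f (min x (y x)) := by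
      refine _root_.le_of_tendsto (hf.stieltjesFunction.mono.tendsto_leftLim _) ?_
      filter_upwards [self_mem_nhdsWithin] with t ht
      exact hf.rightLim_le ht
    have h3 := hy2 x (hut hx)
    have h4 : |f (y x) - f x| = f (max x (y x)) - f (min x (y x)) := by
      rcases le_total x (y x) with h | h
      · rw [max_eq_right h, min_eq_left h, abs_of_nonneg (sub_nonneg.2 (hf h))]
      · rw [max_eq_left h, min_eq_right h, abs_sub_comm, abs_of_nonneg (sub_nonneg.2 (hf h))]
    simp only [hδ]
    change _ ≤ hf.stieltjesFunction (max x (y x))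
      - Function.leftLim hf.stieltjesFunction (min x (y x))
    linarith
  have hsum : ∑' x : u, ENNReal.ofReal (s * δ x)
      ≤ ENNReal.ofReal (f (b + 2 * h) - f (a - 2 * h)) := by
    calc ∑' x : u, ENNReal.ofReal (s * δ x) ≤ ∑' x : u, m (uIcc x.1 (y x)) :=
          ENNReal.tsum_le_tsum fun x => hm x x.2
      _ = m (⋃ x ∈ u, uIcc x (y x)) :=
          (measure_biUnion hucount hud fun x _ => measurableSet_uIcc).symm
      _ ≤ m (Set.Ioc (a - 2 * h) (b + h)) := by
          refine measure_mono (iUnion₂_subset fun x hx => ?_)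
          intro w hw
          have h1 := abs_le.1 (abs_sub_left_of_mem_uIcc hw |>.trans (hy1 x (hut hx)))
          have h2 := hut hx
          exact ⟨by linarith [h1.1, h2.1], by linarith [h1.2, h2.2]⟩
      _ ≤ _ := by
          rw [StieltjesFunction.measure_Ioc]
          refine ENNReal.ofReal_le_ofReal (sub_le_sub ?_ ?_)
          · exact hf.rightLim_le (by linarith)
          · exact hf.le_rightLim le_rfl
  have hvol : ENNReal.ofReal (b - a) ≤ ENNReal.ofReal (3.1 / s)
      * ENNReal.ofReal (f (b + 2 * h) - f (a - 2 * h)) := by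
    calc ENNReal.ofReal (b - a) = volume (Set.Icc a b) := by rw [Real.volume_Icc]
      _ ≤ volume (⋃ x ∈ u, J x) := measure_mono hcov
      _ ≤ ∑' x : u, volume (J x) := measure_biUnion_le _ hucount _
      _ = ∑' x : u, ENNReal.ofReal (3.1 / s) * ENNReal.ofReal (s * δ x) := by
          refine tsum_congr fun x => ?_
          rw [Real.volume_Icc, ← ENNReal.ofReal_mul (by positivity)]
          congr 1
          field_simp
          linarith [hlen x]
      _ = ENNReal.ofReal (3.1 / s) * ∑' x : u, ENNReal.ofReal (s * δ x) := ENNReal.tsum_mul_left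
      _ ≤ _ := by gcongr
  have hmono : f (a - 2 * h) ≤ f (b + 2 * h) :=
    hf (by linarith)
  rw [← ENNReal.ofReal_mul (by positivity), ENNReal.ofReal_le_ofReal_iff
    (mul_nonneg (by positivity) (sub_nonneg.2 hmono)), div_mul_eq_mul_div, le_div_iff₀ hs] at hvol
  linarith

variable {G : Type*} [AddCommGroup G] [Fintype G]

/-- The two degenerate cases, rank zero and radius zero, are settled separately: the argument on a
logarithmic scale needs positive rank and radius. -/
lemma isRegular_of_rank_eq_zero {B : BohrSet G} (hB : B.rank = 0) : B.IsRegular := by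
  have h : B.chars = ∅ := card_eq_zero.1 hB
  have h1 : ∀ ρ, bohrFinset B.chars ρ = univ := fun ρ => by
    ext x; simp [mem_bohrFinset, h]
  intro τ _
  have hG : (Fintype.card G : ℝ) ≠ 0 := by exact_mod_cast Fintype.card_ne_zero
  simp [hB, BohrSet.scaled, BohrSet.toFinset, h1, hG]

lemma isRegular_of_radius_eq_zero {B : BohrSet G} (hB : B.radius = 0) : B.IsRegular := by
  intro τ _
  have hpos : ((bohrFinset B.chars 0).card : ℝ) ≠ 0 := by
    exact_mod_cast (card_bohrFinset_pos le_rfl).ne'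
  simp only [BohrSet.scaled, BohrSet.toFinset, hB, mul_zero, div_self hpos]
  constructor <;> linarith [show 0 ≤ 12 * (B.rank : ℝ) * |τ| by positivity]

/-- Every Bohr set has a regular dilate by a factor bounded below. -/
lemma exists_isRegular (Γ : Finset (AddChar G ℂ)) {ρ : ℝ} (hρ : 0 ≤ ρ) :
    ∃ B : BohrSet G, B.IsRegular ∧ B.chars = Γ ∧ ρ / 2 ^ 16 ≤ B.radius ∧ B.radius ≤ ρ := by
  rcases hρ.eq_or_lt with rfl | hρ0
  · exact ⟨⟨Γ, 0, le_rfl⟩, isRegular_of_radius_eq_zero rfl, rfl, by simp, le_rfl⟩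
  rcases Nat.eq_zero_or_pos Γ.card with hd | hd
  · exact ⟨⟨Γ, ρ, hρ⟩, isRegular_of_rank_eq_zero hd, rfl,
      div_le_self hρ (by norm_num), le_rfl⟩
  have hd1 : (1 : ℝ) ≤ Γ.card := by exact_mod_cast hd
  set d : ℝ := (Γ.card : ℝ) with hdef
  -- On a logarithmic scale for radius and size, regularity follows from a Lipschitz bound for `f`
  -- at one point.
  set f : ℝ → ℝ := fun a => Real.log (bohrFinset Γ (Real.exp a * ρ)).card with hf
  have hcard : ∀ a : ℝ, (0 : ℝ) < (bohrFinset Γ (Real.exp a * ρ)).card := fun a => by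
    exact_mod_cast card_bohrFinset_pos (by positivity)
  have hmono : Monotone f := by
    intro a b hab
    refine Real.log_le_log (hcard a) ?_
    exact_mod_cast card_le_card (bohrFinset_mono subset_rfl (by gcongr))
  have hlog2 := Real.log_two_gt_d9
  set L : ℝ := 16 * Real.log 2 with hL
  have hexpL : Real.exp (-L) = 1 / 2 ^ 16 := by
    rw [hL, Real.exp_neg, show (16 : ℝ) * Real.log 2 = Real.log (2 ^ 16) by
      rw [Real.log_pow]; norm_num, Real.exp_log (by positivity), one_div]
  have hgrow : f 0 - f (-L) ≤ 38 * Real.log 2 * d := by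
    have h1 := card_bohrFinset_le (Γ := Γ) hρ0 (R := 2 ^ 16) (by norm_num)
    have h2 : ((bohrFinset Γ ρ).card : ℝ)
        ≤ (bohrFinset Γ (ρ / (2 ^ 16 : ℕ))).card * ((2 ^ 19) ^ 2) ^ Γ.card := by
      calc ((bohrFinset Γ ρ).card : ℝ)
          ≤ (bohrFinset Γ (ρ / (2 ^ 16 : ℕ))).card * ((4 * (2 ^ 16 : ℕ) + 1) ^ 2) ^ Γ.card := by
            exact_mod_cast h1
        _ ≤ _ := by gcongr; norm_num
    have h3 := hcard (-L)
    have h4 : Real.exp (-L) * ρ = ρ / (2 ^ 16 : ℕ) := by rw [hexpL]; push_cast; ring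
    have h5 : f 0 ≤ f (-L) + 38 * Real.log 2 * d := by
      simp only [hf]
      rw [Real.exp_zero, one_mul]
      rw [h4] at h3 ⊢
      refine (Real.log_le_log (by have := hcard 0; simpa using this) h2).trans (le_of_eq ?_)
      rw [Real.log_mul h3.ne' (by positivity), Real.log_pow, Real.log_pow, Real.log_pow, hdef]
      push_cast; ring
    linarith
  -- The growth of `f` on `[-L, 0]` is at most `38 d log 2`, and `3.1 · 38 log 2 < 8 (16 log 2 -
  -- 4/11)`. The slope `8d`, below `12d`, leaves room for passing between `κ` and `log (1 + κ)` and
  -- for exponentiating; `|κ| ≤ 1/12` gives `|log (1 + κ)| ≤ 1/11`.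
  obtain ⟨a, ⟨ha1, ha2⟩, ha⟩ := hmono.exists_lipschitz_point (a := -L + 2 / 11) (b := -2 / 11)
    (s := 8 * d) (h := 1 / 11) (by rw [hL]; linarith) (by norm_num) (by positivity) (by
      rw [show (-2 / 11 + 2 * (1 / 11) : ℝ) = 0 by norm_num,
        show (-L + 2 / 11 - 2 * (1 / 11) : ℝ) = -L by ring]
      have : (117.8 * Real.log 2) * d < (8 * (L - 4 / 11)) * d := by
        refine mul_lt_mul_of_pos_right ?_ (by positivity)
        rw [hL]; linarith
      nlinarith)
  refine ⟨⟨Γ, Real.exp a * ρ, by positivity⟩, ?_, rfl, ?_, ?_⟩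
  · intro κ hκ
    simp only [BohrSet.rank, BohrSet.scaled, BohrSet.toFinset, ← hdef] at hκ ⊢
    have hκ12 : |κ| ≤ 1 / 12 := by
      have : 12 * |κ| ≤ 12 * d * |κ| := by
        have := abs_nonneg κ
        nlinarith
      linarith
    obtain ⟨hκ1, hκ2⟩ := abs_le.1 hκ12
    have hpos : 0 < 1 + κ := by linarith
    have hrad : (1 + κ) * (Real.exp a * ρ) = Real.exp (a + Real.log (1 + κ)) * ρ := by
      rw [Real.exp_add, Real.exp_log hpos]; ring
    rw [hrad]
    have hlogle : Real.log (1 + κ) ≤ κ := by linarith [Real.log_le_sub_one_of_pos hpos]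
    have hloglow : -(1 / 11) ≤ Real.log (1 + κ) := by
      have h1 := Real.one_sub_inv_le_log_of_pos hpos
      have h2 : (1 + κ)⁻¹ ≤ 12 / 11 := by
        rw [inv_le_comm₀ hpos (by norm_num)]; norm_num; linarith
      linarith
    have hlip := ha (a + Real.log (1 + κ)) (by
      rw [add_sub_cancel_left, abs_le]; exact ⟨hloglow, by linarith⟩)
    rw [add_sub_cancel_left] at hlip
    set N1 : ℝ := ((bohrFinset Γ (Real.exp (a + Real.log (1 + κ)) * ρ)).card : ℝ)
    set N0 : ℝ := ((bohrFinset Γ (Real.exp a * ρ)).card : ℝ)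
    have hN1p : 0 < N1 := hcard _
    have hN0p : 0 < N0 := hcard _
    have hratio : N1 / N0 = Real.exp (f (a + Real.log (1 + κ)) - f a) := by
      simp only [hf]
      rw [Real.exp_sub, Real.exp_log hN1p, Real.exp_log hN0p]
    rw [hratio]
    rcases le_total 0 κ with h0 | h0
    · have hl0 : 0 ≤ Real.log (1 + κ) := Real.log_nonneg (by linarith)
      have hf0 : f a ≤ f (a + Real.log (1 + κ)) := hmono (by linarith)
      rw [abs_of_nonneg hl0, abs_of_nonneg (sub_nonneg.2 hf0)] at hlip
      rw [abs_of_nonneg h0] at hκ ⊢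
      constructor
      · have := Real.one_le_exp (sub_nonneg.2 hf0)
        have : 0 ≤ 12 * d * κ := by positivity
        linarith
      · set t := 12 * d * κ with ht
        have ht0 : 0 ≤ t := by positivity
        have h1 : f (a + Real.log (1 + κ)) - f a ≤ t * Real.log 2 := by
          calc _ ≤ 8 * d * Real.log (1 + κ) := hlip
            _ ≤ 8 * d * κ := by gcongr
            _ = t * (2 / 3) := by rw [ht]; ring
            _ ≤ _ := by gcongr; linarith
        have h2 : Real.exp (t * Real.log 2) ≤ 1 + t := by
          have hc := convexOn_exp.2 (Set.mem_univ 0) (Set.mem_univ (Real.log 2))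
            (sub_nonneg.2 hκ) ht0 (by ring)
          simp only [smul_eq_mul, mul_zero, zero_add, Real.exp_zero,
            Real.exp_log (show (0 : ℝ) < 2 by norm_num)] at hc
          linarith
        exact (Real.exp_le_exp.2 h1).trans h2
    · have hl0 : Real.log (1 + κ) ≤ 0 := Real.log_nonpos hpos.le (by linarith)
      have hf0 : f (a + Real.log (1 + κ)) ≤ f a := hmono (by linarith)
      rw [abs_of_nonpos hl0, abs_of_nonpos (sub_nonpos.2 hf0)] at hlip
      rw [abs_of_nonpos h0] at hκ ⊢
      constructor
      · have h1 : 8 * d * Real.log (1 + κ) ≤ f (a + Real.log (1 + κ)) - f a := by linarith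
        have h2 : 12 / 11 * κ ≤ Real.log (1 + κ) := by
          have h1 := Real.one_sub_inv_le_log_of_pos hpos
          refine le_trans ?_ h1
          have : 1 - (1 + κ)⁻¹ = κ / (1 + κ) := by field_simp; ring
          rw [this, le_div_iff₀ hpos]
          nlinarith
        have h3 : 12 * d * κ ≤ f (a + Real.log (1 + κ)) - f a := by
          have : 8 * d * (12 / 11 * κ) ≤ 8 * d * Real.log (1 + κ) := by gcongr
          nlinarith
        have h4 := Real.add_one_le_exp (f (a + Real.log (1 + κ)) - f a)
        linarith
      · have := Real.exp_le_one_iff.2 (sub_nonpos.2 hf0)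
        have : 0 ≤ 12 * d * -κ := mul_nonneg (by positivity) (by linarith)
        linarith
  · have : Real.exp (-L) ≤ Real.exp a := Real.exp_le_exp.2 (by linarith)
    rw [hexpL] at this
    calc ρ / 2 ^ 16 = 1 / 2 ^ 16 * ρ := by ring
      _ ≤ Real.exp a * ρ := by gcongr
  · have : Real.exp a ≤ 1 := Real.exp_le_one_iff.2 (by linarith)
    calc Real.exp a * ρ ≤ 1 * ρ := by gcongr
      _ = ρ := one_mul _

/-- The upper bound in the definition of regularity, in terms of the absolute radius. -/
lemma BohrSet.IsRegular.card_le {B : BohrSet G} (hB : B.IsRegular) {κ r : ℝ} (hκ0 : 0 ≤ κ)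
    (hκ : 12 * (B.rank : ℝ) * κ ≤ 1) (hr : r ≤ (1 + κ) * B.radius) :
    ((bohrFinset B.chars r).card : ℝ) ≤ (1 + 12 * (B.rank : ℝ) * κ) * B.toFinset.card := by
  have h := (hB κ (by rwa [abs_of_nonneg hκ0])).2
  rw [abs_of_nonneg hκ0, div_le_iff₀ (by exact_mod_cast card_bohrFinset_pos B.radius_nonneg)] at h
  refine le_trans ?_ h
  exact_mod_cast card_le_card (bohrFinset_mono subset_rfl hr)

/-- The lower bound in the definition of regularity, in terms of the absolute radius. -/
lemma BohrSet.IsRegular.le_card {B : BohrSet G} (hB : B.IsRegular) {κ r : ℝ} (hκ0 : 0 ≤ κ)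
    (hκ : 12 * (B.rank : ℝ) * κ ≤ 1) (hr : (1 - κ) * B.radius ≤ r) :
    (1 - 12 * (B.rank : ℝ) * κ) * B.toFinset.card ≤ ((bohrFinset B.chars r).card : ℝ) := by
  have h := (hB (-κ) (by rwa [abs_neg, abs_of_nonneg hκ0])).1
  rw [abs_neg, abs_of_nonneg hκ0,
    le_div_iff₀ (by exact_mod_cast card_bohrFinset_pos B.radius_nonneg)] at h
  refine h.trans ?_
  exact_mod_cast card_le_card (bohrFinset_mono subset_rfl (by linarith))

end Regular

/-! ### Moments of empirical means. -/

section Moments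

/-- Chernoff's bound for the exponential moment of a bounded centred random variable. -/
lemma sum_exp_centred_le {G : Type*} {E : Finset G} (hE : E.Nonempty) {v : G → ℝ}
    (hv0 : ∀ x, 0 ≤ v x) (hv1 : ∀ x, v x ≤ 1) {q t : ℝ} (hq : q = (∑ a ∈ E, v a) / E.card)
    (ht : |t| ≤ 1) :
    ∑ a ∈ E, Real.exp (t * (v a - q)) ≤ E.card * Real.exp (t ^ 2 * q) := by
  have hE0 : (0 : ℝ) < E.card := by exact_mod_cast hE.card_pos
  have hsum : ∑ a ∈ E, v a = E.card * q := by rw [hq]; field_simp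
  have hq0 : 0 ≤ q := by rw [hq]; exact div_nonneg (sum_nonneg fun a _ => hv0 a) hE0.le
  have hq1 : q ≤ 1 := by
    rw [hq, div_le_one hE0]
    calc ∑ a ∈ E, v a ≤ ∑ a ∈ E, (1 : ℝ) := sum_le_sum fun a _ => hv1 a
      _ = E.card := by simp
  -- This is `e^y ≤ 1 + y + y²` for `|y| ≤ 1`. Replacing `v²` by `v` makes the bound linear in `v`,
  -- so that averaging needs only the mean and bounds the variance by `q - q²`.
  have h1 : ∀ a, Real.exp (t * (v a - q))
      ≤ 1 + t * (v a - q) + t ^ 2 * (v a * (1 - 2 * q) + q ^ 2) := by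
    intro a
    have hle : |t * (v a - q)| ≤ 1 := by
      rw [abs_mul]
      refine mul_le_one₀ ht (abs_nonneg _) (abs_le.2 ⟨?_, ?_⟩) <;> linarith [hv0 a, hv1 a]
    have h2 := (abs_le.1 (Real.abs_exp_sub_one_sub_id_le hle)).2
    have h3 : v a ^ 2 ≤ v a := by nlinarith [hv0 a, hv1 a]
    nlinarith [sq_nonneg t]
  calc ∑ a ∈ E, Real.exp (t * (v a - q))
      ≤ ∑ a ∈ E, (1 + t * (v a - q) + t ^ 2 * (v a * (1 - 2 * q) + q ^ 2)) :=
        sum_le_sum fun a _ => h1 a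
    _ = E.card * (1 + t ^ 2 * (q - q ^ 2)) := by
        have h2 : ∀ a, 1 + t * (v a - q) + t ^ 2 * (v a * (1 - 2 * q) + q ^ 2)
            = (1 - t * q + t ^ 2 * q ^ 2) + (t + t ^ 2 * (1 - 2 * q)) * v a := fun a => by ring
        rw [sum_congr rfl fun a _ => h2 a, sum_add_distrib, ← mul_sum, hsum, sum_const,
          nsmul_eq_mul]
        ring
    _ ≤ E.card * Real.exp (t ^ 2 * q) := by
        refine mul_le_mul_of_nonneg_left ?_ hE0.le
        have := Real.add_one_le_exp (t ^ 2 * q)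
        nlinarith [mul_nonneg (sq_nonneg t) (sq_nonneg q)]

/-- Independence: the exponential of a sum factors over the coordinates of `E^m`. -/
lemma sum_piFinset_exp_centred_le {G : Type*} {E : Finset G} (hE : E.Nonempty) {v : G → ℝ}
    (hv0 : ∀ x, 0 ≤ v x) (hv1 : ∀ x, v x ≤ 1) {q t : ℝ} (hq : q = (∑ a ∈ E, v a) / E.card)
    (ht : |t| ≤ 1) (m : ℕ) :
    ∑ a ∈ Fintype.piFinset fun _ : Fin m => E, Real.exp (t * ∑ i, (v (a i) - q))
      ≤ (E.card : ℝ) ^ m * Real.exp (m * (t ^ 2 * q)) := by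
  have h1 : ∑ a ∈ Fintype.piFinset fun _ : Fin m => E, Real.exp (t * ∑ i, (v (a i) - q))
      = (∑ a ∈ E, Real.exp (t * (v a - q))) ^ m := by
    simp only [mul_sum, Real.exp_sum]
    rw [← prod_univ_sum (fun _ : Fin m => E) fun _ a => Real.exp (t * (v a - q))]
    simp
  rw [h1, Real.exp_nat_mul, ← mul_pow]
  exact pow_le_pow_left₀ (sum_nonneg fun a _ => (Real.exp_pos _).le)
    (sum_exp_centred_le hE hv0 hv1 hq ht) m

/-- Moment bound for the empirical mean of `m` independent samples. -/
lemma sum_piFinset_abs_pow_le {G : Type*} {E : Finset G} (hE : E.Nonempty) {v : G → ℝ}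
    (hv0 : ∀ x, 0 ≤ v x) (hv1 : ∀ x, v x ≤ 1) {q α θ : ℝ} (hq : q = (∑ a ∈ E, v a) / E.card)
    (hα : 0 < α) (hθ0 : 0 < θ) (hθ1 : θ ≤ 1) {p m : ℕ} (hp : 0 < p) (hm : 22 * p ≤ m * (θ ^ 2 * α)) :
    ∑ a ∈ Fintype.piFinset fun _ : Fin m => E, |(∑ i, v (a i)) / m - q| ^ (2 * p)
      ≤ (E.card : ℝ) ^ m * (θ * (q + α)) ^ (2 * p) := by
  have hp0 : (0 : ℝ) < p := by exact_mod_cast hp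
  have hE0 : (0 : ℝ) < E.card := by exact_mod_cast hE.card_pos
  have hq0 : 0 ≤ q := by rw [hq]; exact div_nonneg (sum_nonneg fun a _ => hv0 a) hE0.le
  have hm0 : (0 : ℝ) < m := by
    have : 0 < (m : ℝ) * (θ ^ 2 * α) := by linarith
    exact pos_of_mul_pos_left this (by positivity)
  set Q := q + α with hQ
  have hQ0 : 0 < Q := by positivity
  -- The choice of `l` makes the exponent `m l² q` at most `p`. Using `Q = q + α` in place of `q`
  -- keeps `l ≤ 1` even when `q` is tiny.
  set l := Real.sqrt (p / (m * Q)) with hl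
  have hl0 : 0 < l := Real.sqrt_pos.2 (by positivity)
  have hl2 : l ^ 2 = p / (m * Q) := Real.sq_sqrt (by positivity)
  have hpm : (p : ℝ) ≤ m * Q := by
    have h1 : θ ^ 2 * α ≤ 1 * Q := by gcongr; exacts [by nlinarith, by linarith]
    have h2 : m * (θ ^ 2 * α) ≤ m * (1 * Q) := by gcongr
    linarith
  have hl1 : |l| ≤ 1 := by
    rw [abs_of_pos hl0, hl, Real.sqrt_le_one, div_le_one (by positivity)]
    exact hpm
  have hl1' : |-l| ≤ 1 := by rwa [abs_neg]
  have hexp : (m : ℝ) * (l ^ 2 * q) ≤ p := by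
    rw [hl2]
    calc (m : ℝ) * (p / (m * Q) * q) = p * (q / Q) := by field_simp
      _ ≤ p * 1 := by gcongr; rw [div_le_one hQ0]; linarith
      _ = p := mul_one _
  have hpt : ∀ Y : ℝ, l ^ (2 * p) * |Y| ^ (2 * p)
      ≤ ((2 * p).factorial : ℝ) * (Real.exp (l * Y) + Real.exp (-l * Y)) := by
    intro Y
    have h1 := Real.pow_div_factorial_le_exp (l * |Y|) (by positivity) (2 * p)
    rw [div_le_iff₀ (by positivity), mul_pow] at h1
    refine h1.trans ?_
    rw [mul_comm]
    gcongr
    rcases abs_cases Y with ⟨h, _⟩ | ⟨h, _⟩ <;> rw [h]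
    · linarith [Real.exp_pos (-l * Y)]
    · rw [mul_neg, ← neg_mul]; linarith [Real.exp_pos (l * Y)]
  have hmain : l ^ (2 * p) * ∑ a ∈ Fintype.piFinset fun _ : Fin m => E,
      |∑ i, (v (a i) - q)| ^ (2 * p)
      ≤ ((2 * p).factorial : ℝ) * (2 * ((E.card : ℝ) ^ m * Real.exp p)) := by
    rw [mul_sum]
    refine (sum_le_sum fun a _ => hpt _).trans ?_
    rw [← mul_sum, sum_add_distrib]
    gcongr
    have h1 := sum_piFinset_exp_centred_le hE hv0 hv1 hq hl1 m
    have h2 := sum_piFinset_exp_centred_le hE hv0 hv1 hq hl1' m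
    rw [neg_sq] at h2
    have h3 : (E.card : ℝ) ^ m * Real.exp (m * (l ^ 2 * q)) ≤ (E.card : ℝ) ^ m * Real.exp p := by
      gcongr
    linarith
  -- The constant is `22 = 4 · 2 · 2.75`, from `(2p)! ≤ (4p²)^p`, `2 ≤ 2^p` and `e ≤ 2.75`.
  have hfac : ((2 * p).factorial : ℝ) * (2 * Real.exp p) ≤ (22 * (p : ℝ) ^ 2) ^ p := by
    have h1 : ((2 * p).factorial : ℝ) ≤ (4 * (p : ℝ) ^ 2) ^ p := by
      have : ((2 * p).factorial : ℝ) ≤ ((2 * p : ℕ) : ℝ) ^ (2 * p) := by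
        exact_mod_cast Nat.factorial_le_pow (2 * p)
      refine this.trans (le_of_eq ?_)
      rw [pow_mul]; push_cast; ring
    have h2 : (2 : ℝ) ≤ 2 ^ p := by
      calc (2 : ℝ) = 2 ^ 1 := by norm_num
        _ ≤ 2 ^ p := by gcongr; exacts [by norm_num, hp]
    have h3 : Real.exp p ≤ (2.75 : ℝ) ^ p := by
      rw [← mul_one (p : ℝ), Real.exp_nat_mul]
      gcongr
      linarith [Real.exp_one_lt_d9]
    calc _ ≤ (4 * (p : ℝ) ^ 2) ^ p * (2 ^ p * 2.75 ^ p) := by gcongr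
      _ = _ := by rw [← mul_pow, ← mul_pow]; congr 1; ring
  have hY : ∀ a : Fin m → G, |(∑ i, v (a i)) / m - q| ^ (2 * p)
      = |∑ i, (v (a i) - q)| ^ (2 * p) / (m : ℝ) ^ (2 * p) := by
    intro a
    rw [← div_pow]
    congr 1
    rw [sum_sub_distrib]
    simp only [sum_const, card_univ, Fintype.card_fin, nsmul_eq_mul]
    rw [← abs_of_pos hm0, ← abs_div, abs_of_pos hm0]
    congr 1
    field_simp
  simp_rw [hY]
  rw [← sum_div, div_le_iff₀ (by positivity)]
  have hlp : (0 : ℝ) < l ^ (2 * p) := by positivity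
  refine le_of_mul_le_mul_left (hmain.trans ?_) hlp
  calc ((2 * p).factorial : ℝ) * (2 * ((E.card : ℝ) ^ m * Real.exp p))
      = (E.card : ℝ) ^ m * (((2 * p).factorial : ℝ) * (2 * Real.exp p)) := by ring
    _ ≤ (E.card : ℝ) ^ m * (22 * (p : ℝ) ^ 2) ^ p := by gcongr
    _ ≤ (E.card : ℝ) ^ m * (l ^ 2 * (θ * Q) ^ 2 * m ^ 2) ^ p := by
        refine mul_le_mul_of_nonneg_left (pow_le_pow_left₀ (by positivity) ?_ p) (by positivity)
        rw [hl2]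
        have h1 : (p : ℝ) / (m * Q) * (θ * Q) ^ 2 * m ^ 2 = p * (m * (θ ^ 2 * Q)) := by
          field_simp
        rw [h1]
        have h2 : (m : ℝ) * (θ ^ 2 * α) ≤ m * (θ ^ 2 * Q) := by gcongr; linarith
        nlinarith
    _ = _ := by rw [mul_pow, mul_pow, ← pow_mul, ← pow_mul, ← pow_mul]; ring

end Moments

/-! ### Almost-periods by random sampling. -/

section AlmostPeriods

variable {G : Type*} [AddCommGroup G] [Fintype G]

/-- The empirical mean of `m` translates of `f`. -/
def sampleMean {m : ℕ} (f : G → ℝ) (a : Fin m → G) (x : G) : ℝ := (∑ i, f (x - a i)) / m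

open scoped Classical in
/-- Almost-periodicity of `1_A * μ_E` in `ℓ^{2p}`, with an error that is small relative to
`1_A * μ_E` itself. -/
lemma exists_almostPeriods {A E S P W : Finset G} (hE : E.Nonempty) (hP : P.Nonempty)
    (hsupp : ∀ x, conv (indicatorFn A) (muFn E) x ≠ 0 → x ∈ P)
    (hW : ∀ e ∈ E, ∀ s ∈ S, e + s ∈ W) {K : ℝ} (hK : (W.card : ℝ) ≤ K * E.card) (hS : S.Nonempty)
    {α θ : ℝ} (hα : 0 < α) (hθ0 : 0 < θ) (hθ1 : θ ≤ 1) {p m : ℕ} (hp : 0 < p)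
    (hm : 22 * p ≤ m * (θ ^ 2 * α)) :
    ∃ X ⊆ S, (S.card : ℝ) ≤ 2 * K ^ m * X.card ∧ ∀ s ∈ X, ∀ s' ∈ X,
      ellNorm (2 * p) (fun x => conv (indicatorFn A) (muFn E) (x - (s - s'))
        - conv (indicatorFn A) (muFn E) x)
      ≤ 4 * θ * ellNorm (2 * p)
        (fun x => indicatorFn P x * (conv (indicatorFn A) (muFn E) x + α)) := by
  have hn : 2 * p ≠ 0 := by omega
  have hE0 : (0 : ℝ) < E.card := by exact_mod_cast hE.card_pos
  set h := conv (indicatorFn A) (muFn E) with hh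
  have hhq : ∀ x, h x = (∑ y ∈ E, indicatorFn A (x - y)) / E.card := conv_indicatorFn_muFn A E
  have hh0 : ∀ x, 0 ≤ h x := fun x => by
    rw [hhq]; exact div_nonneg (sum_nonneg fun _ _ => indicatorFn_nonneg _ _) hE0.le
  set V := ellNorm (2 * p) (fun x => indicatorFn P x * (h x + α)) with hV
  have hVpow : V ^ (2 * p) = ∑ x, |indicatorFn P x * (h x + α)| ^ (2 * p) := ellNorm_pow hn _
  have hV0 : 0 < V := by
    refine (ellNorm_nonneg _).lt_of_ne' fun h0 => ?_
    rw [← hV] at h0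
    rw [h0, zero_pow hn] at hVpow
    obtain ⟨x, hx⟩ := hP
    have := (sum_eq_zero_iff_of_nonneg (fun x _ => pow_nonneg (abs_nonneg _) _)).1 hVpow.symm x
      (mem_univ x)
    rw [pow_eq_zero_iff hn, abs_eq_zero, indicatorFn_of_mem hx, one_mul] at this
    linarith [hh0 x]
  set Ω := Fintype.piFinset fun _ : Fin m => E with hΩ
  have hΩcard : (Ω.card : ℝ) = (E.card : ℝ) ^ m := by simp [hΩ, Fintype.card_piFinset]
  have hpoint : ∀ x, ∑ a ∈ Ω, |sampleMean (indicatorFn A) a x - h x| ^ (2 * p)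
      ≤ (E.card : ℝ) ^ m * (θ ^ (2 * p) * |indicatorFn P x * (h x + α)| ^ (2 * p)) := by
    intro x
    by_cases hx : x ∈ P
    · rw [indicatorFn_of_mem hx, one_mul, abs_of_nonneg (by linarith [hh0 x]), ← mul_pow]
      exact sum_piFinset_abs_pow_le hE (fun y => indicatorFn_nonneg A (x - y))
        (fun y => indicatorFn_le_one A (x - y)) (hhq x) hα hθ0 hθ1 hp hm
    · have hx0 : h x = 0 := by by_contra h'; exact hx (hsupp x h')
      have h1 : ∀ y ∈ E, indicatorFn A (x - y) = 0 := by
        rw [hhq, div_eq_zero_iff, or_iff_left hE0.ne'] at hx0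
        exact (sum_eq_zero_iff_of_nonneg fun _ _ => indicatorFn_nonneg _ _).1 hx0
      have h2 : ∀ a ∈ Ω, |sampleMean (indicatorFn A) a x - h x| ^ (2 * p) = 0 := by
        intro a ha
        rw [hΩ, Fintype.mem_piFinset] at ha
        rw [hx0, sampleMean, sum_eq_zero fun i _ => h1 (a i) (ha i)]
        simp [hp.ne']
      rw [sum_eq_zero h2]
      positivity
  have htotal : ∑ a ∈ Ω, ∑ x, |sampleMean (indicatorFn A) a x - h x| ^ (2 * p)
      ≤ (E.card : ℝ) ^ m * (θ * V) ^ (2 * p) := by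
    rw [sum_comm, mul_pow, hVpow, mul_sum, mul_sum]
    exact sum_le_sum fun x _ => hpoint x
  -- Markov's inequality for the `2p`-th moment: at most a proportion `2^{-2p} ≤ 1/2` of the tuples
  -- miss by more than twice the typical error.
  set good := Ω.filter fun a => ellNorm (2 * p) (fun x => sampleMean (indicatorFn A) a x - h x)
    ≤ 2 * (θ * V) with hgood
  have hgoodcard : (E.card : ℝ) ^ m ≤ 2 * good.card := by
    set bad := Ω.filter fun a => ¬ ellNorm (2 * p)
      (fun x => sampleMean (indicatorFn A) a x - h x) ≤ 2 * (θ * V) with hbad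
    have hadd : good.card + bad.card = Ω.card := card_filter_add_card_filter_not _
    have h1 : (bad.card : ℝ) * (2 * (θ * V)) ^ (2 * p) ≤ (E.card : ℝ) ^ m * (θ * V) ^ (2 * p) := by
      refine le_trans ?_ htotal
      rw [← nsmul_eq_mul]
      refine (card_nsmul_le_sum bad _ _ fun a ha => ?_).trans
        (sum_le_sum_of_subset_of_nonneg (filter_subset _ _)
          fun a _ _ => sum_nonneg fun x _ => pow_nonneg (abs_nonneg _) _)
      rw [hbad, mem_filter, ellNorm_le_iff hn (by positivity), not_le] at ha
      exact ha.2.le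
    rw [mul_pow, ← mul_assoc] at h1
    have h2 := le_of_mul_le_mul_right h1 (by positivity)
    have h3 : (2 : ℝ) ≤ 2 ^ (2 * p) := by
      calc (2 : ℝ) = 2 ^ 1 := by norm_num
        _ ≤ 2 ^ (2 * p) := by gcongr; exacts [by norm_num, by omega]
    have h4 : (bad.card : ℝ) * 2 ≤ (E.card : ℝ) ^ m :=
      (mul_le_mul_of_nonneg_left h3 (Nat.cast_nonneg _)).trans h2
    have h5 : (good.card : ℝ) + bad.card = (E.card : ℝ) ^ m := by
      rw [← hΩcard]; exact_mod_cast hadd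
    linarith
  set Ψ := Fintype.piFinset fun _ : Fin m => W with hΨ
  have hWne : W.Nonempty := by
    obtain ⟨e, he⟩ := hE
    obtain ⟨s, hs⟩ := hS
    exact ⟨_, hW e he s hs⟩
  have hW0 : (0 : ℝ) < W.card := by exact_mod_cast hWne.card_pos
  have hΨcard : (Ψ.card : ℝ) = (W.card : ℝ) ^ m := by simp [hΨ, Fintype.card_piFinset]
  have hΨne : Ψ.Nonempty := by
    rw [← card_pos]
    have : (0 : ℝ) < Ψ.card := by rw [hΨcard]; positivity
    exact_mod_cast this
  -- The shifted tuples `a + s` all lie in `W^m`, so one tuple `b` is hit by many pairs. Given `b`,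
  -- the shift `s` determines `a`, so the pairs yield distinct shifts.
  obtain ⟨b, -, hb⟩ := exists_le_card_fiber_of_nsmul_le_card_of_maps_to
    (s := good ×ˢ S) (t := Ψ) (f := fun r i => r.1 i + r.2)
    (b := (good.card : ℝ) * S.card / (W.card : ℝ) ^ m) (by
      rintro ⟨a, s⟩ hr
      rw [mem_product, hgood, mem_filter, hΩ, Fintype.mem_piFinset] at hr
      rw [hΨ, Fintype.mem_piFinset]
      exact fun i => hW _ (hr.1.1 i) _ hr.2) hΨne (by
      rw [nsmul_eq_mul, hΨcard, card_product, Nat.cast_mul]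
      exact (mul_div_cancel₀ _ (by positivity)).le)
  set F := (good ×ˢ S).filter fun r => (fun i => r.1 i + r.2) = b with hF
  have hFmem : ∀ r ∈ F, r.1 ∈ good ∧ r.2 ∈ S ∧ ∀ i, r.1 i + r.2 = b i := by
    intro r hr
    rw [hF, mem_filter, mem_product] at hr
    exact ⟨hr.1.1, hr.1.2, fun i => congrFun hr.2 i⟩
  have hinj : Set.InjOn Prod.snd (F : Set ((Fin m → G) × G)) := by
    intro r hr r' hr' heq
    refine Prod.ext (funext fun i => ?_) heq
    have h1 := (hFmem r hr).2.2 i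
    have h2 := (hFmem r' hr').2.2 i
    rw [heq, ← h2] at h1
    exact add_right_cancel h1
  refine ⟨F.image Prod.snd, ?_, ?_, ?_⟩
  · intro s hs
    obtain ⟨r, hr, rfl⟩ := mem_image.1 hs
    exact (hFmem r hr).2.1
  · rw [card_image_of_injOn hinj]
    have hS0 : (0 : ℝ) ≤ S.card := Nat.cast_nonneg _
    have h1 : (W.card : ℝ) ^ m ≤ K ^ m * (E.card : ℝ) ^ m := by
      rw [← mul_pow]; gcongr
    have hKm : 0 < K ^ m := by
      have h3 : 0 < K ^ m * (E.card : ℝ) ^ m := lt_of_lt_of_le (by positivity) h1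
      exact pos_of_mul_pos_left h3 (by positivity)
    rw [div_le_iff₀ (by positivity)] at hb
    have h2 : (E.card : ℝ) ^ m * S.card ≤ (E.card : ℝ) ^ m * (2 * K ^ m * F.card) := by
      calc (E.card : ℝ) ^ m * S.card ≤ 2 * good.card * S.card := by gcongr
        _ = 2 * (good.card * S.card) := by ring
        _ ≤ 2 * (F.card * (W.card : ℝ) ^ m) := by gcongr
        _ ≤ 2 * (F.card * (K ^ m * (E.card : ℝ) ^ m)) := by gcongr
        _ = _ := by ring
    exact le_of_mul_le_mul_left h2 (by positivity)
  -- Translating by `s` turns the samples `a` into `b`. The single function `sampleMean _ b` is thus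
  -- close to `h (x - s)` for every `s` found, and any two of these translates are close to each
  -- other.
  · have key : ∀ s ∈ F.image Prod.snd,
        ellNorm (2 * p) (fun x => sampleMean (indicatorFn A) b x - h (x - s)) ≤ 2 * (θ * V) := by
      intro s hs
      obtain ⟨r, hr, rfl⟩ := mem_image.1 hs
      obtain ⟨hg, -, hb'⟩ := hFmem r hr
      rw [hgood, mem_filter] at hg
      refine le_trans (le_of_eq ?_) hg.2
      rw [← ellNorm_translate (fun x => sampleMean (indicatorFn A) r.1 x - h x) r.2]
      congr 1
      funext x
      congr 1
      simp only [sampleMean]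
      congr 1
      refine sum_congr rfl fun i _ => ?_
      rw [← hb' i]; congr 1; abel
    intro s hs s' hs'
    have h1 := key s hs
    have h2 := key s' hs'
    rw [← ellNorm_translate _ s']
    have h3 : (fun x => h (x - s' - (s - s')) - h (x - s')) = fun x =>
        -(sampleMean (indicatorFn A) b x - h (x - s))
          + (sampleMean (indicatorFn A) b x - h (x - s')) := by
      funext x
      rw [show x - s' - (s - s') = x - s by abel]
      ring
    rw [h3]
    refine (ellNorm_add_le hn _ _).trans ?_
    rw [ellNorm_neg]
    linarith

end AlmostPeriods

/-! ### Chang's theorem relative to a Bohr set. -/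

section Dissociation

variable {G : Type*} [AddCommGroup G] [Fintype G]

/-- `Λ` is dissociated relative to `β`, with threshold `ε`, if all nontrivial products of elements
of `Λ` with exponents in `{-1, 0, 1}` have Fourier coefficient at most `ε`. -/
def IsDissociated (β : G → ℝ) (ε : ℝ) (Λ : Finset (AddChar G ℂ)) : Prop :=
  ∀ ω : AddChar G ℂ → ℤ, (∀ χ ∈ Λ, ω χ ∈ ({-1, 0, 1} : Finset ℤ)) → (∃ χ ∈ Λ, ω χ ≠ 0) →
    ‖ft β (∏ χ ∈ Λ, χ ^ ω χ)‖ ≤ ε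

/-- Exponents on the smaller set extend by `0`. -/
lemma IsDissociated.mono {β : G → ℝ} {ε : ℝ} {Λ Λ' : Finset (AddChar G ℂ)}
    (h : IsDissociated β ε Λ) (hsub : Λ' ⊆ Λ) : IsDissociated β ε Λ' := by
  classical
  intro ω hω hne
  have := h (fun χ => if χ ∈ Λ' then ω χ else 0) (by
      intro χ _
      by_cases hχ : χ ∈ Λ'
      · simpa only [hχ, if_true] using hω χ hχ
      · simp [hχ]) (by
      obtain ⟨χ, hχ, h0⟩ := hne
      exact ⟨χ, hsub hχ, by simpa [hχ] using h0⟩)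
  rwa [← prod_subset hsub (by intro χ _ hχ; simp [hχ]),
    prod_congr rfl (fun χ hχ => by rw [if_pos hχ])] at this

/-- The coefficients of `1 + s Re(c χ)` as a trigonometric polynomial. -/
def rieszCoeff (s : ℝ) (c : ℂ) (j : ℤ) : ℂ :=
  if j = 0 then 1 else if j = 1 then s * c / 2 else s * (starRingEnd ℂ) c / 2

lemma sum_rieszCoeff (s : ℝ) (c : ℂ) (χ : AddChar G ℂ) (x : G) :
    ∑ j ∈ ({-1, 0, 1} : Finset ℤ), rieszCoeff s c j * (χ ^ j) x
      = ((1 + s * (c * χ x).re : ℝ) : ℂ) := by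
  have h1 : (((c * χ x).re : ℝ) : ℂ) = (c * χ x + (starRingEnd ℂ) (c * χ x)) / 2 :=
    Complex.re_eq_add_conj _
  have h2 : χ⁻¹ x = (starRingEnd ℂ) (χ x) := by
    rw [AddChar.inv_apply, AddChar.map_neg_eq_conj]
  have hs : ({-1, 0, 1} : Finset ℤ) = insert (-1) (insert 0 {1}) := rfl
  rw [hs, sum_insert (by decide), sum_insert (by decide), sum_singleton]
  simp only [rieszCoeff, zpow_neg, zpow_one, zpow_zero, h2]
  push_cast
  rw [h1, map_mul]
  norm_num
  ring

lemma sum_norm_rieszCoeff_le {s : ℝ} (hs0 : 0 ≤ s) (hs1 : s ≤ 1) {c : ℂ} (hc : ‖c‖ ≤ 1) :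
    ∑ j ∈ ({-1, 0, 1} : Finset ℤ), ‖rieszCoeff s c j‖ ≤ 2 := by
  have hs : ({-1, 0, 1} : Finset ℤ) = insert (-1) (insert 0 {1}) := rfl
  rw [hs, sum_insert (by decide), sum_insert (by decide), sum_singleton]
  have h : s * ‖c‖ ≤ 1 := mul_le_one₀ hs1 (norm_nonneg c) hc
  simp only [rieszCoeff]
  norm_num [abs_of_nonneg hs0]
  linarith

/-- Riesz products over a dissociated set have bounded mean. -/
lemma sum_riesz_le {β : G → ℝ} (hβ : IsProb β) {ε : ℝ} {Λ : Finset (AddChar G ℂ)}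
    (hΛ : IsDissociated β ε Λ) (hε0 : 0 ≤ ε) (hε : 2 ^ Λ.card * ε ≤ 1) {s : ℝ} (hs0 : 0 ≤ s)
    (hs1 : s ≤ 1) {c : AddChar G ℂ → ℂ} (hc : ∀ χ, ‖c χ‖ ≤ 1) :
    ∑ x, β x * ∏ χ ∈ Λ, (1 + s * (c χ * χ x).re) ≤ 2 := by
  classical
  set I : Finset ℤ := {-1, 0, 1} with hI
  set Ω := Fintype.piFinset fun _ : Λ => I with hΩ
  have hexpand : ((∑ x, β x * ∏ χ ∈ Λ, (1 + s * (c χ * χ x).re) : ℝ) : ℂ)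
      = ∑ ω ∈ Ω, (∏ χ : Λ, rieszCoeff s (c χ) (ω χ)) * ft β (∏ χ : Λ, χ.1 ^ ω χ) := by
    have h1 : ∀ x, ((∏ χ ∈ Λ, (1 + s * (c χ * χ x).re) : ℝ) : ℂ)
        = ∑ ω ∈ Ω, (∏ χ : Λ, rieszCoeff s (c χ) (ω χ)) * (∏ χ : Λ, χ.1 ^ ω χ) x := by
      intro x
      rw [Complex.ofReal_prod, ← prod_coe_sort]
      simp_rw [← sum_rieszCoeff]
      rw [prod_univ_sum]
      refine sum_congr rfl fun ω _ => ?_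
      rw [prod_mul_distrib, AddChar.prod_apply]
    rw [Complex.ofReal_sum]
    simp_rw [Complex.ofReal_mul, h1, mul_sum, ft]
    rw [sum_comm]
    refine sum_congr rfl fun ω _ => ?_
    rw [mul_sum]
    exact sum_congr rfl fun x _ => by ring
  -- Only `ω = 0` contributes a main term. By dissociation the others carry a factor `ε`, and their
  -- coefficients sum to at most `2 ^ |Λ|` in absolute value.
  have hterm : ∀ ω ∈ Ω, ‖(∏ χ : Λ, rieszCoeff s (c χ) (ω χ)) * ft β (∏ χ : Λ, χ.1 ^ ω χ)‖
      ≤ (∏ χ : Λ, ‖rieszCoeff s (c χ) (ω χ)‖) * ε + if ω = 0 then 1 else 0 := by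
    intro ω hω
    rw [norm_mul, norm_prod]
    have hprod0 : 0 ≤ ∏ χ : Λ, ‖rieszCoeff s (c χ) (ω χ)‖ := prod_nonneg fun _ _ => norm_nonneg _
    by_cases h0 : ω = 0
    · subst h0
      have : ∏ χ : Λ, ‖rieszCoeff s (c χ) ((0 : Λ → ℤ) χ)‖ = 1 :=
        prod_eq_one fun χ _ => by simp [rieszCoeff]
      rw [this, if_pos rfl]
      have := norm_ft_le_one hβ (∏ χ : Λ, χ.1 ^ (0 : Λ → ℤ) χ)
      linarith
    · rw [if_neg h0, add_zero]
      refine mul_le_mul_of_nonneg_left ?_ hprod0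
      rw [hΩ, Fintype.mem_piFinset] at hω
      set ω' : AddChar G ℂ → ℤ := fun χ => if h : χ ∈ Λ then ω ⟨χ, h⟩ else 0 with hω'
      have hval : ∀ χ : Λ, ω' χ = ω χ := fun χ => by simp [hω']
      have h1 : ∏ χ : Λ, χ.1 ^ ω χ = ∏ χ ∈ Λ, χ ^ ω' χ := by
        rw [← prod_coe_sort Λ fun χ => χ ^ ω' χ]
        exact prod_congr rfl fun χ _ => by rw [hval]
      rw [h1]
      refine hΛ ω' (fun χ hχ => ?_) ?_
      · have := hω ⟨χ, hχ⟩
        rwa [← hval ⟨χ, hχ⟩] at this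
      · obtain ⟨χ, hχ⟩ := Function.ne_iff.1 h0
        exact ⟨χ.1, χ.2, by rw [hval]; exact hχ⟩
  have hsum : ∑ ω ∈ Ω, ((∏ χ : Λ, ‖rieszCoeff s (c χ) (ω χ)‖) * ε + if ω = 0 then 1 else 0)
      ≤ 2 ^ Λ.card * ε + 1 := by
    rw [sum_add_distrib, ← sum_mul]
    refine add_le_add (mul_le_mul_of_nonneg_right ?_ hε0) ?_
    · rw [hΩ, ← prod_univ_sum (fun _ : Λ => I) fun χ j => ‖rieszCoeff s (c χ) j‖]
      calc ∏ χ : Λ, ∑ j ∈ I, ‖rieszCoeff s (c χ) j‖ ≤ ∏ _χ : Λ, (2 : ℝ) :=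
            prod_le_prod (fun _ _ => sum_nonneg fun _ _ => norm_nonneg _)
              fun χ _ => sum_norm_rieszCoeff_le hs0 hs1 (hc χ)
        _ = 2 ^ Λ.card := by simp
    · rw [sum_ite_eq']
      split_ifs <;> norm_num
  refine (Complex.re_le_norm ((∑ x, β x * ∏ χ ∈ Λ, (1 + s * (c χ * χ x).re) : ℝ) : ℂ)).trans ?_
  rw [hexpand]
  refine (norm_sum_le _ _).trans ((sum_le_sum hterm).trans (hsum.trans ?_))
  linarith

/-- By convexity `exp` lies below its chord on `[-1/2, 1/2]`. This majorises `exp (R / 2)` by a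
constant times a Riesz product. -/
lemma exp_half_le {t : ℝ} (ht : |t| ≤ 1) :
    Real.exp (t / 2) ≤ Real.cosh (1 / 2) * (1 + Real.tanh (1 / 2) * t) := by
  obtain ⟨h1, h2⟩ := abs_le.1 ht
  have hc := convexOn_exp.2 (Set.mem_univ (1 / 2 : ℝ)) (Set.mem_univ (-(1 / 2) : ℝ))
    (show 0 ≤ (1 + t) / 2 by linarith) (show 0 ≤ (1 - t) / 2 by linarith) (by ring)
  simp only [smul_eq_mul] at hc
  have h3 : Real.cosh (1 / 2) * (1 + Real.tanh (1 / 2) * t)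
      = Real.cosh (1 / 2) + Real.sinh (1 / 2) * t := by
    rw [Real.tanh_eq_sinh_div_cosh]
    have := (Real.cosh_pos (1 / 2)).ne'
    field_simp
  rw [h3, Real.cosh_eq, Real.sinh_eq]
  refine le_trans (le_of_eq ?_) (hc.trans (le_of_eq ?_))
  · congr 1; ring
  · ring

/-- Chang's bound: a dissociated subset of the large spectrum of `X` is small. -/
lemma card_le_of_isDissociated {β : G → ℝ} (hβ : IsProb β) {X : Finset G} (hX : X.Nonempty) {K : ℝ}
    (hK : 0 < K) (hXβ : ∀ x, muFn X x ≤ K * β x) {ε : ℝ} {Λ : Finset (AddChar G ℂ)}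
    (hΛ : IsDissociated β ε Λ) (hε0 : 0 ≤ ε) (hε : 2 ^ Λ.card * ε ≤ 1)
    (hspec : ∀ χ ∈ Λ, 1 / 2 ≤ ‖ft (muFn X) χ‖) : (Λ.card : ℝ) ≤ 8 * Real.log (2 * K) := by
  -- The phases `c χ` align the coefficients, so `R` has mean `∑ |ft μ_X χ| ≥ |Λ|/2` under `μ_X`.
  set c : AddChar G ℂ → ℂ := fun χ =>
    (starRingEnd ℂ) (ft (muFn X) χ) / ‖ft (muFn X) χ‖ with hc
  have hc1 : ∀ χ, ‖c χ‖ ≤ 1 := by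
    intro χ
    simp only [hc, norm_div, RCLike.norm_conj, Complex.norm_real, norm_norm]
    exact div_self_le_one _
  have hprob := isProb_muFn hX
  set R : G → ℝ := fun x => ∑ χ ∈ Λ, (c χ * χ x).re with hR
  have hmean : (Λ.card : ℝ) / 2 ≤ ∑ x, muFn X x * R x := by
    have h1 : ∑ x, muFn X x * R x = ∑ χ ∈ Λ, ‖ft (muFn X) χ‖ := by
      simp only [hR, mul_sum]
      rw [sum_comm]
      refine sum_congr rfl fun χ hχ => ?_
      have h2 : ((‖ft (muFn X) χ‖ : ℝ) : ℂ) = c χ * ft (muFn X) χ := by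
        have h0 : (‖ft (muFn X) χ‖ : ℂ) ≠ 0 := by
          have := hspec χ hχ
          exact_mod_cast (by linarith : 0 < ‖ft (muFn X) χ‖).ne'
        simp only [hc]
        rw [div_mul_eq_mul_div, Complex.conj_mul', sq, mul_div_assoc, div_self h0, mul_one]
      have h3 := congrArg Complex.re h2
      rw [Complex.ofReal_re] at h3
      rw [h3, ft, mul_sum, Complex.re_sum]
      refine sum_congr rfl fun x _ => ?_
      rw [← Complex.re_ofReal_mul]
      congr 1
      ring
    rw [h1]
    calc (Λ.card : ℝ) / 2 = ∑ χ ∈ Λ, (1 / 2 : ℝ) := by rw [sum_const, nsmul_eq_mul]; ring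
      _ ≤ _ := sum_le_sum hspec
  have hjensen : Real.exp (∑ x, muFn X x * (R x / 2)) ≤ ∑ x, muFn X x * Real.exp (R x / 2) := by
    have := convexOn_exp.map_sum_le (t := univ) (w := muFn X) (p := fun x => R x / 2)
      (fun x _ => hprob.1 x) hprob.2 (fun _ _ => Set.mem_univ _)
    simpa only [smul_eq_mul] using this
  have hs0 : 0 ≤ Real.tanh (1 / 2) := by
    rw [Real.tanh_eq_sinh_div_cosh]
    exact div_nonneg (Real.sinh_nonneg_iff.2 (by norm_num)) (Real.cosh_pos _).le
  have hs1 : Real.tanh (1 / 2) ≤ 1 := by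
    rw [Real.tanh_eq_sinh_div_cosh, div_le_one (Real.cosh_pos _)]
    exact (Real.sinh_lt_cosh _).le
  have hpoint : ∀ x, Real.exp (R x / 2) ≤ Real.cosh (1 / 2) ^ Λ.card
      * ∏ χ ∈ Λ, (1 + Real.tanh (1 / 2) * (c χ * χ x).re) := by
    intro x
    rw [← prod_const, ← prod_mul_distrib]
    simp only [hR, sum_div, Real.exp_sum]
    refine prod_le_prod (fun _ _ => (Real.exp_pos _).le) fun χ _ => exp_half_le ?_
    refine (Complex.abs_re_le_norm _).trans ?_
    rw [norm_mul, AddChar.norm_apply, mul_one]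
    exact hc1 χ
  have hriesz := sum_riesz_le hβ hΛ hε0 hε hs0 hs1 hc1
  have hcosh : Real.cosh (1 / 2) ^ Λ.card ≤ Real.exp (Λ.card / 8) := by
    have h1 : Real.cosh (1 / 2) ≤ Real.exp (1 / 8) :=
      (Real.cosh_le_exp_half_sq _).trans (by norm_num)
    calc Real.cosh (1 / 2) ^ Λ.card ≤ Real.exp (1 / 8) ^ Λ.card :=
          pow_le_pow_left₀ (Real.cosh_pos _).le h1 _
      _ = _ := by rw [← Real.exp_nat_mul]; congr 1; ring
  -- Jensen bounds the exponential moment below by `e^{|Λ|/4}`, while the Riesz product bounds it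
  -- above by `2K cosh(1/2)^{|Λ|} ≤ 2K e^{|Λ|/8}`.
  have hall : Real.exp (Λ.card / 4) ≤ 2 * K * Real.exp (Λ.card / 8) := by
    calc Real.exp (Λ.card / 4) ≤ Real.exp (∑ x, muFn X x * (R x / 2)) := by
          refine Real.exp_le_exp.2 ?_
          have : ∑ x, muFn X x * (R x / 2) = (∑ x, muFn X x * R x) / 2 := by
            rw [sum_div]; exact sum_congr rfl fun x _ => by ring
          linarith
      _ ≤ ∑ x, muFn X x * Real.exp (R x / 2) := hjensen
      _ ≤ ∑ x, K * β x * (Real.cosh (1 / 2) ^ Λ.card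
            * ∏ χ ∈ Λ, (1 + Real.tanh (1 / 2) * (c χ * χ x).re)) :=
          sum_le_sum fun x _ => mul_le_mul (hXβ x) (hpoint x) (Real.exp_pos _).le
            (mul_nonneg hK.le (hβ.1 x))
      _ = K * Real.cosh (1 / 2) ^ Λ.card
            * ∑ x, β x * ∏ χ ∈ Λ, (1 + Real.tanh (1 / 2) * (c χ * χ x).re) := by
          rw [mul_sum]; exact sum_congr rfl fun x _ => by ring
      _ ≤ K * Real.exp (Λ.card / 8) * 2 :=
          mul_le_mul (mul_le_mul_of_nonneg_left hcosh hK.le) hriesz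
            (sum_nonneg fun x _ => mul_nonneg (hβ.1 x) (by
              refine prod_nonneg fun χ _ => ?_
              have h1 : |(c χ * χ x).re| ≤ 1 := by
                refine (Complex.abs_re_le_norm _).trans ?_
                rw [norm_mul, AddChar.norm_apply, mul_one]
                exact hc1 χ
              nlinarith [(abs_le.1 h1).1])) (by positivity)
      _ = _ := by ring
  have h1 : Real.exp (Λ.card / 8) ≤ 2 * K := by
    refine le_of_mul_le_mul_right (le_trans (le_of_eq ?_) hall) (Real.exp_pos (Λ.card / 8 : ℝ))
    rw [← Real.exp_add]; congr 1; ring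
  have h2 := (Real.le_log_iff_exp_le (by positivity)).2 h1
  linarith

lemma norm_mul_char_sub_one_le (χ ψ : AddChar G ℂ) (t : G) :
    ‖(χ * ψ) t - 1‖ ≤ ‖χ t - 1‖ + ‖ψ t - 1‖ := by
  have : (χ * ψ) t - 1 = (χ t - 1) * ψ t + (ψ t - 1) := by rw [AddChar.mul_apply]; ring
  rw [this]
  refine (norm_add_le _ _).trans ?_
  rw [norm_mul, AddChar.norm_apply, mul_one]

lemma norm_inv_char_sub_one (χ : AddChar G ℂ) (t : G) : ‖χ⁻¹ t - 1‖ = ‖χ t - 1‖ := by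
  rw [AddChar.inv_apply, norm_char_neg_sub_one]

lemma norm_prod_char_sub_one_le (Λ : Finset (AddChar G ℂ)) (ω : AddChar G ℂ → ℤ)
    (hω : ∀ χ ∈ Λ, ω χ ∈ ({-1, 0, 1} : Finset ℤ)) (t : G) :
    ‖(∏ χ ∈ Λ, χ ^ ω χ) t - 1‖ ≤ ∑ χ ∈ Λ, ‖χ t - 1‖ := by
  classical
  induction Λ using Finset.induction_on with
  | empty => simp
  | insert a s ha ih =>
    rw [prod_insert ha, sum_insert ha]
    refine (norm_mul_char_sub_one_le _ _ _).trans
      (add_le_add ?_ (ih fun χ hχ => hω χ (mem_insert_of_mem hχ)))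
    have h := hω a (mem_insert_self _ _)
    simp only [mem_insert, mem_singleton] at h
    rcases h with h | h | h <;> rw [h]
    · rw [zpow_neg, zpow_one, norm_inv_char_sub_one]
    · simp
    · rw [zpow_one]

open scoped Classical in
/-- The large spectrum of `X` is controlled by few characters, up to characters at which `β` has a
not too small Fourier coefficient. -/
lemma exists_spectrum_control {β : G → ℝ} (hβ : IsProb β) {X : Finset G} (hX : X.Nonempty) {K : ℝ}
    (hK : 0 < K) (hXβ : ∀ x, muFn X x ≤ K * β x) {N : ℕ} (hN : 8 * Real.log (2 * K) < N) :
    ∃ Λ : Finset (AddChar G ℂ), Λ.card ≤ N ∧ ∀ (t : G) (η : ℝ), 0 ≤ η →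
      (∀ ψ : AddChar G ℂ, (1 / 2) ^ N < ‖ft β ψ‖ → ‖ψ t - 1‖ ≤ η) →
      ∀ γ : AddChar G ℂ, 1 / 2 ≤ ‖ft (muFn X) γ‖ → ‖γ t - 1‖ ≤ η + ∑ χ ∈ Λ, ‖χ t - 1‖ := by
  set ε : ℝ := (1 / 2) ^ N with hε
  set Δ : Finset (AddChar G ℂ) := univ.filter fun γ => 1 / 2 ≤ ‖ft (muFn X) γ‖ with hΔ
  set F := Δ.powerset.filter fun Λ => IsDissociated β ε Λ with hF
  have hFne : F.Nonempty := by
    refine ⟨∅, ?_⟩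
    rw [hF, mem_filter]
    exact ⟨empty_mem_powerset _, fun ω _ ⟨χ, hχ, _⟩ => absurd hχ (notMem_empty _)⟩
  obtain ⟨Λ, hΛF, hmax⟩ := exists_max_image F Finset.card hFne
  rw [hF, mem_filter, mem_powerset] at hΛF
  obtain ⟨hΛΔ, hΛ⟩ := hΛF
  have hcard : Λ.card ≤ N := by
    by_contra! hlt
    -- Truncating to exactly `N` elements makes `2^N ε = 1`, as Chang's bound requires.
    obtain ⟨Λ', hsub, hcard'⟩ := exists_subset_card_eq hlt.le
    have := card_le_of_isDissociated hβ hX hK hXβ (hΛ.mono hsub) (by positivity)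
      (by rw [hcard', hε, ← mul_pow]; norm_num)
      (fun χ hχ => (mem_filter.1 (hΛΔ (hsub hχ))).2)
    rw [hcard'] at this
    linarith
  refine ⟨Λ, hcard, fun t η hη hψ γ hγ => ?_⟩
  by_cases hγΛ : γ ∈ Λ
  · have := single_le_sum (f := fun χ : AddChar G ℂ => ‖χ t - 1‖) (fun _ _ => norm_nonneg _) hγΛ
    linarith
  -- By maximality, `γ^{±1}` times a product of powers of elements of `Λ` equals a character `ψ`
  -- with `|ft β ψ| > ε`; the triangle inequality then bounds `γ t - 1`.
  have hnot : ¬ IsDissociated β ε (insert γ Λ) := by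
    intro h
    have hmem : insert γ Λ ∈ F := by
      rw [hF, mem_filter, mem_powerset]
      exact ⟨insert_subset (mem_filter.2 ⟨mem_univ _, hγ⟩) hΛΔ, h⟩
    have := hmax _ hmem
    rw [card_insert_of_notMem hγΛ] at this
    omega
  rw [IsDissociated] at hnot
  push Not at hnot
  obtain ⟨ω, hω, ⟨χ₀, hχ₀, hne⟩, hbig⟩ := hnot
  have hωΛ : ∀ χ ∈ Λ, ω χ ∈ ({-1, 0, 1} : Finset ℤ) := fun χ hχ => hω χ (mem_insert_of_mem hχ)
  rw [prod_insert hγΛ] at hbig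
  have hγ0 : ω γ ≠ 0 := by
    intro h0
    rw [h0, zpow_zero, one_mul] at hbig
    refine absurd (hΛ ω hωΛ ⟨χ₀, ?_, hne⟩) (not_le.2 hbig)
    rcases mem_insert.1 hχ₀ with rfl | h
    · exact absurd h0 hne
    · exact h
  have hprod := norm_prod_char_sub_one_le Λ ω hωΛ t
  have hpow : ‖(γ ^ ω γ) t - 1‖ = ‖γ t - 1‖ := by
    have h := hω γ (mem_insert_self _ _)
    simp only [mem_insert, mem_singleton] at h
    rcases h with h | h | h
    · rw [h, zpow_neg, zpow_one, norm_inv_char_sub_one]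
    · exact absurd h hγ0
    · rw [h, zpow_one]
  have h1 := norm_mul_char_sub_one_le (γ ^ ω γ * ∏ χ ∈ Λ, χ ^ ω χ) (∏ χ ∈ Λ, χ ^ ω χ)⁻¹ t
  rw [mul_inv_cancel_right, hpow, norm_inv_char_sub_one] at h1
  have h2 := hψ _ hbig
  linarith

/-- A character with a large Fourier coefficient on a regular Bohr set is almost constant on a
narrower one. -/
lemma BohrSet.IsRegular.norm_char_sub_one_le {D : BohrSet G} (hD : D.IsRegular) {δ : ℝ}
    (hδ0 : 0 ≤ δ) (hδ : 12 * (D.rank : ℝ) * δ ≤ 1) {ψ : AddChar G ℂ}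
    (hψ : 1 / 2 ≤ ‖ft (muFn D.toFinset) ψ‖) {t : G} (ht : t ∈ bohrFinset D.chars (δ * D.radius)) :
    ‖ψ t - 1‖ ≤ 48 * (D.rank : ℝ) * δ := by
  have hD0 : (0 : ℝ) < D.toFinset.card := by exact_mod_cast card_bohrFinset_pos D.radius_nonneg
  -- Translation by `t` changes the indicator only on the collar `P \ Q`, of size at most `24 d δ
  -- |D|` by regularity. Dividing by a coefficient of size at least `1/2` gives `48 d δ`.
  set P := bohrFinset D.chars ((1 + δ) * D.radius) with hP
  set Q := bohrFinset D.chars ((1 - δ) * D.radius) with hQ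
  have hQP : ∀ x, indicatorFn Q x ≤ indicatorFn P x := by
    intro x
    by_cases hx : x ∈ Q
    · have : x ∈ P := bohrFinset_mono subset_rfl
        (mul_le_mul_of_nonneg_right (by linarith) D.radius_nonneg) hx
      rw [indicatorFn_of_mem hx, indicatorFn_of_mem this]
    · rw [indicatorFn_of_notMem hx]; exact indicatorFn_nonneg _ _
  have hpt : ∀ x, |indicatorFn D.toFinset (x - t) - indicatorFn D.toFinset x|
      ≤ indicatorFn P x - indicatorFn Q x := by
    intro x
    by_cases hx : x ∈ Q
    · have h1 : x ∈ D.toFinset := bohrFinset_mono subset_rfl (by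
        nlinarith [mul_nonneg hδ0 D.radius_nonneg]) hx
      have h2 : x - t ∈ D.toFinset := bohrFinset_mono subset_rfl (by
        nlinarith [mul_nonneg hδ0 D.radius_nonneg]) (sub_mem_bohrFinset hx ht)
      rw [indicatorFn_of_mem h1, indicatorFn_of_mem h2, sub_self, abs_zero]
      linarith [hQP x]
    · rw [indicatorFn_of_notMem hx, sub_zero]
      by_cases hx' : x ∈ P
      · rw [indicatorFn_of_mem hx', abs_le]
        constructor <;> linarith [indicatorFn_nonneg D.toFinset x, indicatorFn_le_one D.toFinset x,
          indicatorFn_nonneg D.toFinset (x - t), indicatorFn_le_one D.toFinset (x - t)]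
      · have h1 : x ∉ D.toFinset := fun h => hx' (bohrFinset_mono subset_rfl (by
          nlinarith [mul_nonneg hδ0 D.radius_nonneg]) h)
        have h2 : x - t ∉ D.toFinset := fun h => hx' (by
          have := add_mem_bohrFinset h ht
          rw [sub_add_cancel] at this
          exact bohrFinset_mono subset_rfl (by linarith) this)
        rw [indicatorFn_of_notMem h1, indicatorFn_of_notMem h2, indicatorFn_of_notMem hx']
        simp
  have hsum : ∑ x, |indicatorFn D.toFinset (x - t) - indicatorFn D.toFinset x|
      ≤ 24 * (D.rank : ℝ) * δ * D.toFinset.card := by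
    refine (sum_le_sum fun x _ => hpt x).trans ?_
    rw [sum_sub_distrib, sum_indicatorFn, sum_indicatorFn]
    have h1 := hD.card_le hδ0 hδ (r := (1 + δ) * D.radius) le_rfl
    have h2 := hD.le_card hδ0 hδ (r := (1 - δ) * D.radius) le_rfl
    linarith
  have hmul : (ψ t - 1) * ft (muFn D.toFinset) ψ
      = ft (fun x => muFn D.toFinset (x - t) - muFn D.toFinset x) ψ := by
    rw [ft_sub (fun x => muFn D.toFinset (x - t)), ft_translate]; ring
  have hle : ‖ψ t - 1‖ * ‖ft (muFn D.toFinset) ψ‖ ≤ 24 * (D.rank : ℝ) * δ := by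
    rw [← norm_mul, hmul]
    refine (norm_sum_le _ _).trans ?_
    calc ∑ x, ‖((muFn D.toFinset (x - t) - muFn D.toFinset x : ℝ) : ℂ) * ψ x‖
        = (∑ x, |indicatorFn D.toFinset (x - t) - indicatorFn D.toFinset x|)
            / D.toFinset.card := by
          rw [sum_div]
          refine sum_congr rfl fun x _ => ?_
          rw [norm_mul, AddChar.norm_apply, mul_one, Complex.norm_real, Real.norm_eq_abs, muFn,
            muFn, ← sub_div, abs_div, abs_of_pos hD0]
      _ ≤ _ := by rwa [div_le_iff₀ hD0]
  nlinarith [norm_nonneg (ψ t - 1)]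

/-- Each averaging step reaches only `r` further, so constancy survives `j` steps at the cost of `j
r` in the radius. -/
lemma convIter_muFn_eq_of_eqOn {Γ : Finset (AddChar G ℂ)} {r v : ℝ} (hr : 0 ≤ r) {g : G → ℝ}
    (j : ℕ) {R : ℝ} (hg : ∀ x ∈ bohrFinset Γ (R + j * r), g x = v) :
    ∀ x ∈ bohrFinset Γ R, convIter (muFn (bohrFinset Γ r)) g j x = v := by
  have hprob : IsProb (muFn (bohrFinset Γ r)) := isProb_muFn ⟨0, zero_mem_bohrFinset hr⟩
  induction j generalizing R with
  | zero => intro x hx; exact hg x (by simpa using hx)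
  | succ j ih =>
    intro x hx
    have h1 := ih (R := R + r) (by
      intro y hy
      refine hg y ?_
      convert! hy using 2
      push_cast; ring)
    rw [convIter_succ, conv_apply', ← one_mul v, ← hprob.2, sum_mul]
    refine sum_congr rfl fun y _ => ?_
    by_cases hy : muFn (bohrFinset Γ r) y = 0
    · rw [hy, zero_mul, zero_mul]
    · rw [h1 _ (sub_mem_bohrFinset hx (mem_of_muFn_ne_zero hy))]

/-- Chang's theorem relative to a regular Bohr set. -/
lemma exists_annihilator {S D : BohrSet G} (hS : S.IsRegular) (hD : D.IsRegular)
    (hSD : D.chars = S.chars) {N : ℕ} {κ δ : ℝ} (hκ0 : 0 ≤ κ) (hκ : 12 * (S.rank : ℝ) * κ ≤ 1)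
    (hrad : N * D.radius ≤ κ * S.radius) (hδ0 : 0 ≤ δ) (hδ : 12 * (S.rank : ℝ) * δ ≤ 1)
    {X : Finset G} (hX : X.Nonempty) (hXS : X ⊆ S.toFinset)
    (hN : 8 * Real.log (4 * (S.toFinset.card / X.card)) < N) :
    ∃ Λ : Finset (AddChar G ℂ), Λ.card ≤ N ∧ ∀ t ∈ bohrFinset S.chars (δ * D.radius),
      ∀ γ : AddChar G ℂ, 1 / 2 ≤ ‖ft (muFn X) γ‖ →
        ‖γ t - 1‖ ≤ 48 * (S.rank : ℝ) * δ + ∑ χ ∈ Λ, ‖χ t - 1‖ := by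
  have hrank : D.rank = S.rank := by rw [BohrSet.rank, BohrSet.rank, hSD]
  have hX0 : (0 : ℝ) < X.card := by exact_mod_cast hX.card_pos
  have hS0 : (0 : ℝ) < S.toFinset.card := by exact_mod_cast card_bohrFinset_pos S.radius_nonneg
  set Sp := bohrFinset S.chars ((1 + κ) * S.radius) with hSp
  have hSpr : 0 ≤ (1 + κ) * S.radius := mul_nonneg (by linarith) S.radius_nonneg
  have hSp0 : (0 : ℝ) < Sp.card := by exact_mod_cast card_bohrFinset_pos hSpr
  have hSpcard : (Sp.card : ℝ) ≤ 2 * S.toFinset.card := by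
    have := hS.card_le hκ0 hκ (r := (1 + κ) * S.radius) le_rfl
    nlinarith
  have hDprob : IsProb (muFn D.toFinset) := isProb_muFn ⟨0, zero_mem_bohrFinset D.radius_nonneg⟩
  have hSpprob : IsProb (muFn Sp) := isProb_muFn ⟨0, zero_mem_bohrFinset hSpr⟩
  -- Starting from a slightly larger Bohr set keeps `β` constant on `S`, so it dominates `μ_X` up to
  -- the factor `2|S|/|X|`. The `N` factors `μ_D` give `|ft β ψ| ≤ 2^{-N}` unless `|ft μ_D ψ| ≥
  -- 1/2`, in which case `ψ` is almost `1` on a narrow dilate of `D`.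
  set β := convIter (muFn D.toFinset) (muFn Sp) N with hβdef
  have hβ : IsProb β := isProb_convIter hDprob hSpprob N
  have hβS : ∀ x ∈ S.toFinset, β x = 1 / Sp.card := by
    have := convIter_muFn_eq_of_eqOn (Γ := S.chars) (r := D.radius) (v := 1 / Sp.card)
      (g := muFn Sp) D.radius_nonneg N (R := S.radius) (by
        intro x hx
        rw [muFn, indicatorFn_of_mem (bohrFinset_mono subset_rfl (by linarith) hx)])
    intro x hx
    have h2 := this x hx
    rwa [← hSD] at h2
  have hXβ : ∀ x, muFn X x ≤ 2 * (S.toFinset.card / X.card) * β x := by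
    intro x
    by_cases hx : x ∈ X
    · rw [hβS x (hXS hx), muFn, indicatorFn_of_mem hx]
      calc 1 / (X.card : ℝ) = Sp.card / X.card * (1 / Sp.card) := by field_simp
        _ ≤ 2 * S.toFinset.card / X.card * (1 / Sp.card) := by gcongr
        _ = _ := by ring
    · rw [muFn, indicatorFn_of_notMem hx, zero_div]
      exact mul_nonneg (by positivity) (hβ.1 x)
  obtain ⟨Λ, hcard, hctl⟩ := exists_spectrum_control hβ hX (by positivity) hXβ (N := N) (by
    refine lt_of_eq_of_lt ?_ hN
    congr 2; ring)
  refine ⟨Λ, hcard, fun t ht γ hγ => hctl t _ (by positivity) ?_ γ hγ⟩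
  intro ψ hψ
  rw [← hrank] at hδ ⊢
  refine hD.norm_char_sub_one_le hδ0 hδ ?_ (by rwa [hSD])
  by_contra! hlt
  refine absurd hψ (not_lt.2 ?_)
  rw [hβdef, ft_convIter, norm_mul, norm_pow]
  calc ‖ft (muFn Sp) ψ‖ * ‖ft (muFn D.toFinset) ψ‖ ^ N
      ≤ 1 * (1 / 2) ^ N := by
        gcongr
        exact norm_ft_le_one hSpprob ψ
    _ = _ := one_mul _

end Dissociation

/-! ### Smoothing by almost-periods, and the case without increment. -/

section Smoothing

variable {G : Type*} [AddCommGroup G] [Fintype G]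

/-- The kernel `μ_E * (μ_X * μ_{-X}) * ⋯ * (μ_X * μ_{-X})` with `k` factors `μ_X * μ_{-X}`. -/
def smoothKernel (X E : Finset G) (k : ℕ) : G → ℝ :=
  convIter (conv (muFn X) fun x => muFn X (-x)) (muFn E) k

lemma isProb_conv_muFn_neg {X : Finset G} (hX : X.Nonempty) :
    IsProb (conv (muFn X) fun x => muFn X (-x)) := by
  have h := isProb_muFn hX
  refine h.conv ⟨fun x => h.1 _, ?_⟩
  rw [← h.2]
  exact Equiv.sum_comp (Equiv.neg G) (muFn X)

lemma isProb_smoothKernel {X E : Finset G} (hX : X.Nonempty) (hE : E.Nonempty) (k : ℕ) :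
    IsProb (smoothKernel X E k) :=
  isProb_convIter (isProb_conv_muFn_neg hX) (isProb_muFn hE) k

lemma norm_ft_smoothKernel (X E : Finset G) (k : ℕ) (γ : AddChar G ℂ) :
    ‖ft (smoothKernel X E k) γ‖ = ‖ft (muFn E) γ‖ * ‖ft (muFn X) γ‖ ^ (2 * k) := by
  rw [smoothKernel, ft_convIter, norm_mul, norm_pow, ft_conv, norm_mul, norm_ft_neg, ← sq, pow_mul]

lemma smoothKernel_support {X E : Finset G} {Γ : Finset (AddChar G ℂ)} {s : ℝ}
    (hX : X ⊆ bohrFinset Γ s) (k : ℕ) {y : G} (hy : smoothKernel X E k y ≠ 0) :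
    ∃ e ∈ E, ∃ z ∈ bohrFinset Γ (2 * k * s), y = e + z := by
  induction k generalizing y with
  | zero => exact ⟨y, mem_of_muFn_ne_zero hy, 0, by simp [mem_bohrFinset], by simp⟩
  | succ k ih =>
    rw [smoothKernel, convIter_succ] at hy
    obtain ⟨u, v, hu, hv, rfl⟩ := conv_ne_zero hy
    obtain ⟨a, b, ha, hb, rfl⟩ := conv_ne_zero hv
    obtain ⟨e, he, z, hz, rfl⟩ := ih hu
    have h2 := hX (mem_of_muFn_ne_zero ha)
    have h3 := neg_mem_bohrFinset (hX (mem_of_muFn_ne_zero hb))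
    rw [neg_neg] at h3
    have h4 := add_mem_bohrFinset hz (add_mem_bohrFinset h2 h3)
    refine ⟨e, he, _, ?_, add_assoc _ _ _⟩
    convert! h4 using 2
    push_cast; ring

lemma sum_muFn_sq {G : Type*} [Fintype G] {E : Finset G} (hE : E.Nonempty) : ∑ x, muFn E x ^ 2 = 1 / (E.card : ℝ) := by
  have hE0 : (E.card : ℝ) ≠ 0 := by exact_mod_cast hE.card_pos.ne'
  simp_rw [sq]
  rw [sum_muFn_mul, sum_congr rfl fun x hx => by rw [muFn, indicatorFn_of_mem hx], sum_const,
    nsmul_eq_mul]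
  field_simp

/-- If `t` nearly annihilates the large spectrum of `X`, then `1_A * μ_E * (μ_X * μ_{-X})^{*k}` is
nearly invariant under translation by `t`. The set `Q` serves to localise `A`. -/
lemma abs_conv_smoothKernel_translate_sub_le {A E X Q : Finset G} (hE : E.Nonempty) {k : ℕ} {t : G}
    (hQ : ∀ y, smoothKernel X E k y ≠ 0 → y ∈ Q) (hQt : ∀ y, smoothKernel X E k y ≠ 0 → y + t ∈ Q)
    {K η : ℝ} (hK0 : 0 ≤ K) (hη0 : 0 ≤ η) (hK : (Q.card : ℝ) ≤ K * E.card)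
    (hη : ∀ γ : AddChar G ℂ, ‖ft (muFn X) γ‖ ^ (2 * k) * ‖γ t - 1‖ ≤ η) (x : G) :
    |conv (indicatorFn A) (smoothKernel X E k) (x - t)
      - conv (indicatorFn A) (smoothKernel X E k) x| ≤ Real.sqrt K * η := by
  have hE0 : (0 : ℝ) < E.card := by exact_mod_cast hE.card_pos
  have hG0 : (0 : ℝ) < Fintype.card G := by exact_mod_cast Fintype.card_pos
  set w := smoothKernel X E k with hw
  -- Cutting `1_A` off to `Q` gives `‖a‖₂² ≤ |Q| ≤ K|E|`, while Parseval gives `‖b‖₂² ≤ η²/|E|`.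
  -- Cauchy–Schwarz then loses only `√K`, independently of the density of `E` in `G`.
  set a : G → ℝ := fun y => indicatorFn Q y * indicatorFn A (x - y) with ha
  set b : G → ℝ := fun y => w (y - t) - w y with hb
  have hdiff : conv (indicatorFn A) w (x - t) - conv (indicatorFn A) w x = ∑ y, a y * b y := by
    rw [conv_apply', conv_apply', ← Equiv.sum_comp (Equiv.subRight t), ← sum_sub_distrib]
    refine sum_congr rfl fun y _ => ?_
    simp only [Equiv.subRight_apply, ha, hb]
    rw [show x - t - (y - t) = x - y by abel]
    by_cases hy : y ∈ Q
    · rw [indicatorFn_of_mem hy]; ring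
    · have h1 : w y = 0 := by by_contra h; exact hy (hQ y h)
      have h2 : w (y - t) = 0 := by
        by_contra h
        have := hQt _ h
        rw [sub_add_cancel] at this
        exact hy this
      rw [h1, h2]; ring
  have hasq : ∑ y, a y ^ 2 ≤ Q.card := by
    rw [← sum_indicatorFn]
    refine sum_le_sum fun y _ => ?_
    simp only [ha]
    have h1 := indicatorFn_nonneg Q y
    have h2 := indicatorFn_le_one Q y
    have h3 := indicatorFn_nonneg A (x - y)
    have h4 := indicatorFn_le_one A (x - y)
    have h5 : indicatorFn Q y * indicatorFn A (x - y) ≤ indicatorFn Q y :=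
      mul_le_of_le_one_right h1 h4
    nlinarith [mul_nonneg h1 h3]
  have hbsq : ∑ y, b y ^ 2 ≤ η ^ 2 / E.card := by
    have h1 : Fintype.card G * ∑ y, b y ^ 2 ≤ η ^ 2 * (Fintype.card G * ∑ y, muFn E y ^ 2) := by
      rw [← sum_norm_ft_sq, ← sum_norm_ft_sq, mul_sum]
      refine sum_le_sum fun γ _ => ?_
      rw [← mul_pow]
      refine pow_le_pow_left₀ (norm_nonneg _) ?_ 2
      have h2 : ft b γ = (γ t - 1) * ft w γ := by
        rw [hb, ft_sub (fun y => w (y - t)), ft_translate]; ring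
      rw [h2, norm_mul, hw, norm_ft_smoothKernel]
      calc ‖γ t - 1‖ * (‖ft (muFn E) γ‖ * ‖ft (muFn X) γ‖ ^ (2 * k))
          = ‖ft (muFn X) γ‖ ^ (2 * k) * ‖γ t - 1‖ * ‖ft (muFn E) γ‖ := by ring
        _ ≤ η * ‖ft (muFn E) γ‖ := mul_le_mul_of_nonneg_right (hη γ) (norm_nonneg _)
    rw [sum_muFn_sq hE] at h1
    refine le_of_mul_le_mul_left (h1.trans (le_of_eq ?_)) hG0
    ring
  rw [hdiff]
  refine abs_le_of_sq_le_sq ?_ (by positivity)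
  calc (∑ y, a y * b y) ^ 2 ≤ (∑ y, a y ^ 2) * ∑ y, b y ^ 2 := sum_mul_sq_le_sq_mul_sq _ _ _
    _ ≤ K * E.card * (η ^ 2 / E.card) :=
        mul_le_mul (hasq.trans hK) hbsq (sum_nonneg fun _ _ => sq_nonneg _) (by positivity)
    _ = (Real.sqrt K * η) ^ 2 := by
        rw [mul_pow, Real.sq_sqrt hK0]; field_simp

/-- A bounded function that is close to its upper bound on average has large self-convolution. -/
lemma le_conv_self {f : G → ℝ} {M : ℝ} (hM : 0 ≤ M) (hf1 : ∀ x, f x ≤ M)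
    {B W : Finset G} (hfW : ∀ x, f x ≠ 0 → x ∈ W) {x : G} (hBW : B ⊆ W)
    (hxB : ∀ y ∈ B, x - y ∈ W) :
    M ^ 2 * B.card - 2 * M * (M * W.card - ∑ y, f y) ≤ conv f f x := by
  -- Writing `f = M 1_W - g` with `g ≥ 0` of small mass, the term `g * g` is nonnegative and can be
  -- dropped.
  set g : G → ℝ := fun y => M * indicatorFn W y - f y with hg
  have hg0 : ∀ y, 0 ≤ g y := by
    intro y
    simp only [hg]
    by_cases hy : y ∈ W
    · rw [indicatorFn_of_mem hy]; linarith [hf1 y]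
    · have : f y = 0 := by by_contra h; exact hy (hfW y h)
      rw [indicatorFn_of_notMem hy, this]; simp
  have hgsum : ∑ y, g y = M * W.card - ∑ y, f y := by
    simp only [hg, sum_sub_distrib, ← mul_sum, sum_indicatorFn]
  have hgsum' : ∑ y, g (x - y) = ∑ y, g y := Equiv.sum_comp (Equiv.subLeft x) g
  have hpt : ∀ y, M ^ 2 * indicatorFn B y - M * g y - M * g (x - y) ≤ f y * f (x - y) := by
    intro y
    have h1 : f y = M * indicatorFn W y - g y := by simp [hg]
    have h2 : f (x - y) = M * indicatorFn W (x - y) - g (x - y) := by simp [hg]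
    have h3 : indicatorFn B y ≤ indicatorFn W y * indicatorFn W (x - y) := by
      by_cases hy : y ∈ B
      · rw [indicatorFn_of_mem hy, indicatorFn_of_mem (hBW hy), indicatorFn_of_mem (hxB y hy),
          one_mul]
      · rw [indicatorFn_of_notMem hy]
        exact mul_nonneg (indicatorFn_nonneg _ _) (indicatorFn_nonneg _ _)
    have h4 : indicatorFn W y * (M * g (x - y)) ≤ M * g (x - y) :=
      mul_le_of_le_one_left (mul_nonneg hM (hg0 _)) (indicatorFn_le_one _ _)
    have h5 : indicatorFn W (x - y) * (M * g y) ≤ M * g y :=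
      mul_le_of_le_one_left (mul_nonneg hM (hg0 _)) (indicatorFn_le_one _ _)
    have h6 := mul_le_mul_of_nonneg_left h3 (sq_nonneg M)
    have h7 := mul_nonneg (hg0 y) (hg0 (x - y))
    rw [h1, h2]
    linarith
  calc M ^ 2 * B.card - 2 * M * (M * W.card - ∑ y, f y)
      = ∑ y, (M ^ 2 * indicatorFn B y - M * g y - M * g (x - y)) := by
        rw [sum_sub_distrib, sum_sub_distrib, ← mul_sum, ← mul_sum, ← mul_sum, hgsum',
          sum_indicatorFn, hgsum]
        ring
    _ ≤ conv f f x := sum_le_sum fun y _ => hpt y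

/-- The pairing of `1_A * κ * μ * μ` with `1_{-A}` is an average of values of the
self-convolution of `1_A * μ`. -/
lemma sum_conv_conv_neg (A : Finset G) (w μ : G → ℝ) :
    ∑ x ∈ A, conv (conv (conv (indicatorFn A) w) μ) μ (-x)
      = ∑ z, w z * conv (conv (indicatorFn A) μ) (conv (indicatorFn A) μ) (-z) := by
  set f := conv (indicatorFn A) μ with hf
  have h1 : conv (conv (conv (indicatorFn A) w) μ) μ = conv w (conv f μ) := by
    rw [conv_right_comm (indicatorFn A) w μ, conv_right_comm _ w μ, conv_comm]
  have h2 : ∀ z, ∑ x ∈ A, conv f μ (-x - z) = conv f f (-z) := by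
    intro z
    simp only [conv]
    rw [sum_comm]
    refine sum_congr rfl fun y _ => ?_
    rw [← mul_sum]
    congr 1
    rw [hf, conv, sum_indicatorFn_mul A fun u => μ (-z - y - u)]
    exact sum_congr rfl fun u _ => by congr 1; abel
  rw [h1]
  simp only [← h2, mul_sum]
  rw [sum_comm]
  rfl

/-- The power mean inequality on `A`, which is Hölder's inequality against `1_{-A}`. -/
lemma sum_abs_le_of_ellNorm_le {n : ℕ} (hn : n ≠ 0) {A : Finset G} {u : G → ℝ} {b : ℝ} (hb : 0 ≤ b)
    (hu : ellNorm n u ≤ b * (A.card : ℝ) ^ ((1 : ℝ) / n)) : ∑ x ∈ A, |u (-x)| ≤ b * A.card := by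
  rcases A.eq_empty_or_nonempty with rfl | hA
  · simp
  have hA0 : (0 : ℝ) < A.card := by exact_mod_cast hA.card_pos
  rw [ellNorm_le_iff hn (by positivity), mul_pow, one_div,
    Real.rpow_inv_natCast_pow hA0.le hn] at hu
  have h1 : ∑ x ∈ A, |u (-x)| ^ n ≤ ∑ x, |u x| ^ n := by
    rw [← Equiv.sum_comp (Equiv.neg G) fun x => |u x| ^ n]
    exact sum_le_sum_of_subset_of_nonneg (subset_univ A) fun _ _ _ => pow_nonneg (abs_nonneg _) _
  obtain ⟨j, rfl⟩ := Nat.exists_eq_succ_of_ne_zero hn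
  have h2 := pow_sum_div_card_le_sum_pow (s := A) (f := fun x => |u (-x)|) (n := j)
    (fun x _ => abs_nonneg _)
  rw [div_le_iff₀ (by positivity)] at h2
  refine le_of_pow_le_pow_left₀ hn (by positivity) (h2.trans ?_)
  calc (∑ x ∈ A, |u (-x)| ^ (j + 1)) * (A.card : ℝ) ^ j
      ≤ b ^ (j + 1) * A.card * (A.card : ℝ) ^ j := by gcongr; exact h1.trans hu
    _ = (b * A.card) ^ (j + 1) := by rw [mul_pow, pow_succ (A.card : ℝ)]; ring

/-- The density-increment-free case: if `1_A * μ_T` is bounded by `3α/2`, and `1_A * μ_E` can be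
replaced by an approximation that is nearly invariant under `T`, then `1_A * μ_E` is large on
average over `-A`. -/
lemma le_sum_conv_of_forall_le {B T : BohrSet G} (hB : B.IsRegular) {A E X : Finset G}
    (hA : A ⊆ B.toFinset) (hE : E.Nonempty) (hX : X.Nonempty) {α κ θ : ℝ} (hα0 : 0 < α)
    (hα : α * B.toFinset.card ≤ A.card) (hκ0 : 0 ≤ κ) (hκ : 12 * (B.rank : ℝ) * κ ≤ 1 / 40)
    {p k : ℕ} (hp0 : 0 < p) (hp : 2 / α ≤ 4 ^ p) (hθ : k * θ ≤ 1 / 100)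
    (hTB : T.toFinset ⊆ bohrFinset B.chars (κ * B.radius))
    (hker : ∀ y, smoothKernel X E k y ≠ 0 → y ∈ bohrFinset B.chars (κ * B.radius))
    (hperiod : ∀ s ∈ X, ∀ s' ∈ X,
      ellNorm (2 * p) (fun x => conv (indicatorFn A) (muFn E) (x - (s - s'))
        - conv (indicatorFn A) (muFn E) x)
      ≤ 4 * θ * ellNorm (2 * p) (fun x => indicatorFn (bohrFinset B.chars ((1 + κ) * B.radius)) x
          * (conv (indicatorFn A) (muFn E) x + α)))
    (hsmooth : ∀ x, ∀ t ∈ T.toFinset, |conv (indicatorFn A) (smoothKernel X E k) (x - t)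
      - conv (indicatorFn A) (smoothKernel X E k) x| ≤ α / 100)
    (hT : ∀ x, conv (indicatorFn A) (muFn T.toFinset) x ≤ 3 / 2 * α) :
    α / 4 * A.card ≤ ∑ x ∈ A, conv (indicatorFn A) (muFn E) (-x) := by
  have hn : 2 * p ≠ 0 := by omega
  have hB0 : (0 : ℝ) < B.toFinset.card := by exact_mod_cast card_bohrFinset_pos B.radius_nonneg
  have hA0 : (0 : ℝ) < A.card := lt_of_lt_of_le (by positivity) hα
  set W := bohrFinset B.chars ((1 + κ) * B.radius) with hW
  set h := conv (indicatorFn A) (muFn E) with hh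
  set w := smoothKernel X E k with hw
  set hk := conv (indicatorFn A) w with hhk
  set V := ellNorm (2 * p) (fun x => indicatorFn W x * (h x + α)) with hV
  set a₀ := (A.card : ℝ) ^ ((1 : ℝ) / (2 * p : ℕ)) with ha₀
  have ha₀0 : 0 ≤ a₀ := by positivity
  have ha₀pow : a₀ ^ (2 * p) = A.card := by
    rw [ha₀, one_div, Real.rpow_inv_natCast_pow hA0.le hn]
  have hTprob : IsProb (muFn T.toFinset) := isProb_muFn ⟨0, zero_mem_bohrFinset T.radius_nonneg⟩
  have hwprob : IsProb w := isProb_smoothKernel hX hE k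
  have hWcard : (W.card : ℝ) ≤ (1 + 1 / 40) * B.toFinset.card := by
    have := hB.card_le hκ0 (hκ.trans (by norm_num)) (r := (1 + κ) * B.radius) le_rfl
    nlinarith
  have hκr : 0 ≤ κ * B.radius := mul_nonneg hκ0 B.radius_nonneg
  -- the approximation error
  have herr : ellNorm (2 * p) (fun x => hk x - h x) ≤ V / 25 := by
    have h1 : hk = convIter (conv (muFn X) fun x => muFn X (-x)) h k := conv_convIter _ _ _ _
    have h2 : ellNorm (2 * p) (fun x => conv h (conv (muFn X) fun x => muFn X (-x)) x - h x)
        ≤ 4 * θ * V := by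
      refine ellNorm_conv_sub_le hn (isProb_conv_muFn_neg hX) h fun y hy => ?_
      obtain ⟨s, s', hs, hs', rfl⟩ := conv_ne_zero hy
      have := hperiod s (mem_of_muFn_ne_zero hs) (-s') (mem_of_muFn_ne_zero hs')
      rwa [sub_neg_eq_add] at this
    rw [h1]
    refine (ellNorm_convIter_sub_le hn (isProb_conv_muFn_neg hX) h k).trans ?_
    have hV0 : 0 ≤ V := ellNorm_nonneg _
    calc (k : ℝ) * _ ≤ k * (4 * θ * V) := by gcongr
      _ = 4 * (k * θ) * V := by ring
      _ ≤ 4 * (1 / 100) * V := by gcongr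
      _ = V / 25 := by ring
  -- pointwise bounds on the approximation
  have hkT : ∀ x, |conv hk (muFn T.toFinset) x - hk x| ≤ α / 100 :=
    abs_conv_sub_le hTprob fun x y hy => hsmooth x y (mem_of_muFn_ne_zero hy)
  have hkle : ∀ x, hk x ≤ 2 * α := by
    intro x
    have h1 : conv hk (muFn T.toFinset) x ≤ 3 / 2 * α := by
      rw [hhk, conv_right_comm]
      exact conv_le_of_le hwprob hT x
    have h2 := (abs_le.1 (hkT x)).1
    linarith
  have hh0 : ∀ x, 0 ≤ h x := conv_nonneg (indicatorFn_nonneg A) (isProb_muFn hE).1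
  -- The bound improves itself: on `W`, `h + α ≤ |h_k - h| + 3α`, so `V ≤ V/25 + 6 α a₀`. Passing
  -- from `|W|` to `|A|` costs only a factor `2` after the `2p`-th root, because `|W| ≤ 4^p |A|`.
  have hVle : V ≤ 25 / 4 * α * a₀ := by
    have h1 : V ≤ ellNorm (2 * p) (fun x => hk x - h x)
        + ellNorm (2 * p) (fun x => 3 * α * indicatorFn W x) := by
      have h3 : ellNorm (2 * p) (fun x => |hk x - h x|) ≤ ellNorm (2 * p) (fun x => hk x - h x) :=
        ellNorm_mono hn fun x => (abs_abs _).le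
      refine le_trans (ellNorm_mono hn fun x => ?_) ((ellNorm_add_le hn (fun x => |hk x - h x|)
        fun x => 3 * α * indicatorFn W x).trans (add_le_add_left h3 _))
      have h4 := indicatorFn_nonneg W x
      have h5 : 0 ≤ h x + α := by linarith [hh0 x]
      rw [abs_of_nonneg (mul_nonneg h4 h5), abs_of_nonneg (by positivity)]
      by_cases hx : x ∈ W
      · rw [indicatorFn_of_mem hx]
        linarith [neg_abs_le (hk x - h x), hkle x]
      · rw [indicatorFn_of_notMem hx]
        simp
    have h2 : ellNorm (2 * p) (fun x => 3 * α * indicatorFn W x) ≤ 6 * α * a₀ := by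
      rw [ellNorm_le_iff hn (by positivity), mul_pow (6 * α), ha₀pow]
      have h3 : ∀ x, |3 * α * indicatorFn W x| ^ (2 * p)
          = (3 * α) ^ (2 * p) * indicatorFn W x := by
        intro x
        by_cases hx : x ∈ W
        · rw [indicatorFn_of_mem hx, mul_one, mul_one, abs_of_pos (by positivity)]
        · rw [indicatorFn_of_notMem hx, mul_zero, mul_zero, abs_zero, zero_pow hn]
      rw [sum_congr rfl fun x _ => h3 x, ← mul_sum, sum_indicatorFn]
      have h4 : (W.card : ℝ) ≤ 4 ^ p * A.card := by
        calc (W.card : ℝ) ≤ 2 * B.toFinset.card := by linarith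
          _ = 2 / α * (α * B.toFinset.card) := by field_simp
          _ ≤ 4 ^ p * A.card := by gcongr
      calc (3 * α) ^ (2 * p) * (W.card : ℝ) ≤ (3 * α) ^ (2 * p) * (4 ^ p * A.card) := by gcongr
        _ = (6 * α) ^ (2 * p) * A.card := by
            rw [show (6 * α) = 2 * (3 * α) by ring, mul_pow 2, pow_mul 2]; norm_num; ring
    linarith
  have hpair : ∑ x ∈ A, |hk (-x) - h (-x)| ≤ 1 / 4 * α * A.card := by
    refine sum_abs_le_of_ellNorm_le hn (by positivity) (u := fun x => hk x - h x) ?_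
    rw [← ha₀]
    linarith
  -- the main term
  set f := conv (indicatorFn A) (muFn T.toFinset) with hf
  -- With `M = 3α/2` and `|W| ≤ (41/40)|B|`, the lower bound is `3α|A| - 2.3625 α²|B| ≥ 0.6375
  -- α|A|`.
  have hself : ∀ z, w z ≠ 0 → 3 / 5 * α * A.card ≤ conv f f (-z) := by
    intro z hz
    have hzB := hker z hz
    have hBW : B.toFinset ⊆ W := bohrFinset_mono subset_rfl (by linarith)
    have h1 := le_conv_self (f := f) (M := 3 / 2 * α) (B := B.toFinset) (W := W) (x := -z)
      (by positivity) hT (by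
        intro x hx
        obtain ⟨y, y', hy, hy', rfl⟩ := conv_ne_zero hx
        have := add_mem_bohrFinset (hA (mem_of_indicatorFn_ne_zero hy))
          (hTB (mem_of_muFn_ne_zero hy'))
        exact bohrFinset_mono subset_rfl (by linarith) this) hBW (by
        intro y hy
        have := sub_mem_bohrFinset (neg_mem_bohrFinset hzB) hy
        exact bohrFinset_mono subset_rfl (by linarith) this)
    have h2 : ∑ y, f y = A.card := by rw [hf, sum_conv, hTprob.2, mul_one, sum_indicatorFn]
    rw [h2] at h1
    refine le_trans ?_ h1
    have h3 : α ^ 2 * (W.card : ℝ) ≤ α ^ 2 * ((1 + 1 / 40) * B.toFinset.card) := by gcongr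
    have h4 : α * (α * B.toFinset.card) ≤ α * A.card := by gcongr
    nlinarith
  have hmain : 3 / 5 * α * A.card
      ≤ ∑ x ∈ A, conv (conv hk (muFn T.toFinset)) (muFn T.toFinset) (-x) := by
    rw [hhk, sum_conv_conv_neg]
    calc 3 / 5 * α * (A.card : ℝ) = ∑ z, w z * (3 / 5 * α * A.card) := by
          rw [← sum_mul, hwprob.2, one_mul]
      _ ≤ _ := by
          refine sum_le_sum fun z _ => ?_
          by_cases hz : w z = 0
          · rw [hz, zero_mul, zero_mul]
          · exact mul_le_mul_of_nonneg_left (hself z hz) (hwprob.1 z)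
  have hkTT : ∀ x, conv (conv hk (muFn T.toFinset)) (muFn T.toFinset) x ≤ hk x + α / 50 := by
    intro x
    have h1 : ∀ y, conv hk (muFn T.toFinset) y - hk y ≤ α / 100 := fun y => (abs_le.1 (hkT y)).2
    have h2 := conv_le_of_le hTprob h1 x
    have h3 : conv (fun y => conv hk (muFn T.toFinset) y - hk y) (muFn T.toFinset) x
        = conv (conv hk (muFn T.toFinset)) (muFn T.toFinset) x - conv hk (muFn T.toFinset) x := by
      simp only [conv, sub_mul, sum_sub_distrib]
    linarith [h1 x]
  have hlow : 3 / 5 * α * A.card - α / 50 * A.card ≤ ∑ x ∈ A, hk (-x) := by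
    have h1 : ∑ x ∈ A, conv (conv hk (muFn T.toFinset)) (muFn T.toFinset) (-x)
        ≤ ∑ x ∈ A, (hk (-x) + α / 50) := sum_le_sum fun x _ => hkTT _
    rw [sum_add_distrib, sum_const, nsmul_eq_mul] at h1
    linarith
  have hdiff : ∑ x ∈ A, hk (-x) - ∑ x ∈ A, h (-x) ≤ ∑ x ∈ A, |hk (-x) - h (-x)| := by
    rw [← sum_sub_distrib]
    exact sum_le_sum fun x _ => le_abs_self _
  -- The balance is `3/5 - 1/50 - 1/4 = 33/100 ≥ 1/4`.
  nlinarith [mul_pos hα0 hA0]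

end Smoothing

/-! ### Counting progressions, and the choice of parameters. -/

section Main

variable {G : Type*} [AddCommGroup G] [Fintype G]

-- For given `x` and `y` the third term is `2y - x = (-x) - (-2y)`, so the count is a sum of values
-- of a convolution. Odd order makes doubling injective, so the image of `A'` has `|A'|` elements.
open scoped Classical in
lemma threeAPCount_eq (hG : Odd (Fintype.card G)) {A A' : Finset G} (hA' : A'.Nonempty) :
    (threeAPCount A A' A : ℝ) = A'.card *
      ∑ x ∈ A, conv (indicatorFn A) (muFn (A'.image fun y => -(2 • y))) (-x) := by
  have hinj : Function.Injective fun y : G => 2 • y := by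
    have hco : (Nat.card G).Coprime 2 := by
      rw [Nat.card_eq_fintype_card]; exact Nat.coprime_two_right.2 hG
    exact (nsmulCoprime hco).injective
  have hinj' : Function.Injective fun y : G => -(2 • y) := neg_injective.comp hinj
  have hA'0 : (A'.card : ℝ) ≠ 0 := by exact_mod_cast hA'.card_pos.ne'
  have h1 : ∀ x, (A'.card : ℝ) * conv (indicatorFn A) (muFn (A'.image fun y => -(2 • y))) (-x)
      = ∑ y ∈ A', indicatorFn A (2 • y - x) := by
    intro x
    rw [conv_indicatorFn_muFn, card_image_of_injective _ hinj', sum_image fun a _ b _ h => hinj' h,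
      mul_div_cancel₀ _ hA'0]
    exact sum_congr rfl fun y _ => by congr 1; abel
  rw [mul_sum, sum_congr rfl fun x _ => h1 x, threeAPCount, card_filter]
  push_cast
  rw [sum_product]
  refine sum_congr rfl fun x _ => ?_
  rw [sum_product]
  refine sum_congr rfl fun y _ => ?_
  rw [← sum_indicatorFn_mul A fun z => if x + z = 2 • y then (1 : ℝ) else 0]
  simp_rw [← eq_sub_iff_add_eq', mul_ite, mul_one, mul_zero]
  rw [sum_ite_eq' univ (2 • y - x), if_pos (mem_univ _)]

/-- The choice of the exponent `2p`, of the number `k` of smoothing steps, of the number `m` of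
samples and of the bound `N` on the number of new characters. -/
lemma exists_parameters {α : ℝ} (hα0 : 0 < α) (hα1 : α ≤ 1) :
    ∃ p k m N : ℕ, 0 < p ∧ 2 / α ≤ 4 ^ p ∧ 0 < k ∧ 2 * (1 / 4 : ℝ) ^ k ≤ α ^ 2 / 200 ∧
      22 * p ≤ m * ((1 / (100 * k : ℝ)) ^ 2 * α) ∧ 8 * Real.log (8 * (2 / α) ^ m) < N ∧
      (k : ℝ) ≤ 10 * Real.log (2 / α) ∧ (N : ℝ) ≤ 5 * 10 ^ 8 * α⁻¹ * Real.log (2 / α) ^ 4 := by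
  set l := Real.log (2 / α) with hl
  have h2α : 0 < 2 / α := by positivity
  have hl2 : Real.log 2 ≤ l := Real.log_le_log (by norm_num) (by rw [le_div_iff₀ hα0]; linarith)
  have hl69 : (0.69 : ℝ) ≤ l := by linarith [Real.log_two_gt_d9]
  have hl0 : 0 < l := by linarith
  have hexp : Real.exp l = 2 / α := Real.exp_log h2α
  have hpow : ∀ n : ℕ, Real.exp n ≤ 4 ^ n := by
    intro n
    rw [← mul_one (n : ℝ), Real.exp_nat_mul]
    exact pow_le_pow_left₀ (Real.exp_pos _).le (by linarith [Real.exp_one_lt_d9]) n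
  set p := ⌈l⌉₊ with hp
  have hpl : l ≤ p := Nat.le_ceil l
  have hpu : (p : ℝ) ≤ 2.5 * l := by linarith [Nat.ceil_lt_add_one hl0.le]
  -- The ceiling gives `4^⌈2l⌉ ≥ (2/α)²`, and the extra `4` supplies a factor `256`, more than the
  -- `100` needed.
  set k := ⌈2 * l⌉₊ + 4 with hk
  have hku : (k : ℝ) ≤ 10 * l := by
    rw [hk]; push_cast
    linarith [Nat.ceil_lt_add_one (show 0 ≤ 2 * l by positivity)]
  have hk4 : (4 : ℝ) ≤ k := by rw [hk]; push_cast; linarith [Nat.cast_nonneg (α := ℝ) ⌈2 * l⌉₊]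
  have hk0 : (0 : ℝ) < k := by linarith
  set m := ⌈22 * p / ((1 / (100 * k : ℝ)) ^ 2 * α)⌉₊ with hm
  have hmu : (m : ℝ) ≤ 6 * 10 ^ 7 * l ^ 3 / α := by
    have h1 := Nat.ceil_lt_add_one
      (show 0 ≤ 22 * p / ((1 / (100 * k : ℝ)) ^ 2 * α) by positivity)
    have h2 : 22 * p / ((1 / (100 * k : ℝ)) ^ 2 * α) = 220000 * (p * k ^ 2) / α := by
      field_simp; ring
    have h3 : (p : ℝ) * k ^ 2 ≤ 2.5 * l * (10 * l) ^ 2 := by gcongr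
    have h4 : (1 : ℝ) ≤ 4 * l ^ 3 / α := by
      rw [le_div_iff₀ hα0]
      have : (0.69 : ℝ) ^ 3 ≤ l ^ 3 := by gcongr
      norm_num at this
      linarith
    have h5 : 220000 * (p * (k : ℝ) ^ 2) / α ≤ 220000 * (2.5 * l * (10 * l) ^ 2) / α := by gcongr
    rw [h2] at h1
    have h6 : 220000 * (2.5 * l * (10 * l) ^ 2) / α + 4 * l ^ 3 / α ≤ 6 * 10 ^ 7 * l ^ 3 / α := by
      rw [← add_div]
      gcongr
      have : 0 ≤ l ^ 3 := by positivity
      nlinarith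
    have h7 : (m : ℝ) < 220000 * (p * (k : ℝ) ^ 2) / α + 1 := by
      rw [hm, h2]; exact h1
    linarith
  set y := 8 * Real.log (8 * (2 / α) ^ m) with hy
  have hyeq : y = 24 * Real.log 2 + 8 * (m * l) := by
    rw [hy, Real.log_mul (by norm_num) (by positivity), Real.log_pow,
      show (8 : ℝ) = 2 ^ 3 by norm_num, Real.log_pow]
    push_cast; ring
  have hy0 : 0 ≤ y := by rw [hyeq]; have := Real.log_two_gt_d9; positivity
  refine ⟨p, k, m, ⌊y⌋₊ + 1, Nat.ceil_pos.2 hl0, ?_, by omega, ?_, ?_, ?_, hku, ?_⟩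
  · rw [← hexp]
    exact (Real.exp_le_exp.2 hpl).trans (hpow p)
  · have h1 : (400 / α ^ 2 : ℝ) ≤ 4 ^ k := by
      have h2 : (2 / α) ^ 2 ≤ (4 : ℝ) ^ ⌈2 * l⌉₊ := by
        rw [← hexp, ← Real.exp_nat_mul]
        refine (Real.exp_le_exp.2 ?_).trans (hpow _)
        push_cast
        exact Nat.le_ceil _
      rw [hk, pow_add]
      have h3 : (400 / α ^ 2 : ℝ) = 100 * (2 / α) ^ 2 := by field_simp; norm_num
      rw [h3]
      have : (0 : ℝ) ≤ (2 / α) ^ 2 := by positivity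
      nlinarith
    rw [one_div, inv_pow]
    have h4 : ((4 : ℝ) ^ k)⁻¹ ≤ (400 / α ^ 2)⁻¹ := inv_anti₀ (by positivity) h1
    rw [inv_div] at h4
    linarith
  · have h1 := Nat.le_ceil (22 * p / ((1 / (100 * k : ℝ)) ^ 2 * α))
    rwa [div_le_iff₀ (by positivity)] at h1
  · push_cast; exact Nat.lt_floor_add_one y
  · push_cast
    have h1 := Nat.floor_le hy0
    have h2 : 8 * (m * l) ≤ 8 * (6 * 10 ^ 7 * l ^ 3 / α * l) := by gcongr
    have h3 : 8 * (6 * 10 ^ 7 * l ^ 3 / α * l) = 4.8 * 10 ^ 8 * (α⁻¹ * l ^ 4) := by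
      rw [div_eq_mul_inv]; ring
    have h4 : (0.2 : ℝ) ≤ α⁻¹ * l ^ 4 := by
      have h5 : (0.69 : ℝ) ^ 4 ≤ l ^ 4 := by gcongr
      have h6 : 1 ≤ α⁻¹ := (one_le_inv₀ hα0).2 hα1
      norm_num at h5
      nlinarith
    have := Real.log_two_lt_d9
    rw [mul_assoc]
    linarith

set_option maxHeartbeats 1000000 in
/-- Either there are many three-term progressions, or there is a density increment; with explicit
parameters. -/
lemma count_or_increment {B B' : BohrSet G} (hB : B.IsRegular) (hB' : B'.IsRegular) {c : ℝ}
    (hc0 : 0 ≤ c) (hc : c ≤ 1 / 1000) (hBB' : B'.toFinset ⊆ B.scaled (c / (B.rank : ℝ))) {α : ℝ}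
    (hα0 : 0 < α) (hα1 : α ≤ 1) {A E : Finset G} (hA : A ⊆ B.toFinset) (hE : E ⊆ B'.toFinset)
    (hαA : α * B.toFinset.card ≤ A.card) (hαE : α * B'.toFinset.card ≤ E.card)
    {p k m N : ℕ} (hp0 : 0 < p) (hp : 2 / α ≤ 4 ^ p) (hk0 : 0 < k)
    (hk : 2 * (1 / 4 : ℝ) ^ k ≤ α ^ 2 / 200) (hm : 22 * p ≤ m * ((1 / (100 * k : ℝ)) ^ 2 * α))
    (hN : 8 * Real.log (8 * (2 / α) ^ m) < N) :
    α / 4 * A.card ≤ ∑ x ∈ A, conv (indicatorFn A) (muFn E) (-x) ∨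
    ∃ T : BohrSet G, T.IsRegular ∧ T.IsSubBohr B' ∧ T.rank ≤ B'.rank + N ∧
      α ^ 2 * min B'.radius 2 / (10 ^ 8 * 2 ^ 48 * k * N * max (B'.rank : ℝ) 1 ^ 3) ≤ T.radius ∧
      ∃ x, 3 / 2 * α ≤ conv (indicatorFn A) (muFn T.toFinset) x := by
  classical
  set d : ℝ := (B'.rank : ℝ) with hd
  set d₁ : ℝ := max d 1 with hd₁
  have hd0 : 0 ≤ d := Nat.cast_nonneg _
  have hd₁1 : 1 ≤ d₁ := le_max_right _ _
  have hdd₁ : d ≤ d₁ := le_max_left _ _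
  have hd₁0 : 0 < d₁ := by linarith
  set ρ := B'.radius with hρ
  have hρ0 : 0 ≤ ρ := B'.radius_nonneg
  -- Capping the radius at `2` makes `N * D.radius ≤ 1`, so that the `N` new characters contribute
  -- at most `δ` in all.
  set ρ₀ := min ρ 2 with hρ₀
  have hρ₀0 : 0 ≤ ρ₀ := le_min hρ0 (by norm_num)
  have hρ₀ρ : ρ₀ ≤ ρ := min_le_left _ _
  have hk1 : (1 : ℝ) ≤ k := by exact_mod_cast hk0
  have h2α : 1 ≤ 2 / α := by rw [le_div_iff₀ hα0]; linarith
  have hN0 : (0 : ℝ) < N := by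
    refine lt_of_le_of_lt ?_ hN
    have : (1 : ℝ) ≤ (2 / α) ^ m := one_le_pow₀ h2α
    exact mul_nonneg (by norm_num) (Real.log_nonneg (by linarith))
  have hN1 : (1 : ℝ) ≤ N := by
    have : 0 < N := by exact_mod_cast hN0
    exact_mod_cast this
  have hB0 : (0 : ℝ) < B.toFinset.card := by exact_mod_cast card_bohrFinset_pos B.radius_nonneg
  have hB'0 : (0 : ℝ) < B'.toFinset.card := by exact_mod_cast card_bohrFinset_pos hρ0
  have hEne : E.Nonempty := by
    rw [← card_pos]
    have : (0 : ℝ) < E.card := lt_of_lt_of_le (by positivity) hαE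
    exact_mod_cast this
  -- the Bohr sets containing the almost-periods, and in which dissociation is tested
  obtain ⟨S, hSreg, hSchars, hSlow, hSup⟩ := exists_isRegular B'.chars
    (ρ := ρ₀ / (100 * d₁ * k)) (by positivity)
  have hS0 : 0 ≤ S.radius := S.radius_nonneg
  have hSrank : (S.rank : ℝ) = d := by rw [hd, BohrSet.rank, BohrSet.rank, hSchars]
  -- The `2k` shifts from `X` and `-X`, and a shift from `T`, must together stay in the collar of
  -- relative width `1/(12 d₁)` on which regularity of `B'` is used.
  have hkS : k * S.radius ≤ ρ₀ / (100 * d₁) := by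
    calc k * S.radius ≤ k * (ρ₀ / (100 * d₁ * k)) := by gcongr
      _ = ρ₀ / (100 * d₁) := by field_simp
  have hSk : S.radius ≤ k * S.radius := le_mul_of_one_le_left hS0 hk1
  obtain ⟨D, hDreg, hDchars, hDlow, hDup⟩ := exists_isRegular S.chars
    (ρ := S.radius / (12 * d₁ * N)) (by positivity)
  have hD0 : 0 ≤ D.radius := D.radius_nonneg
  have hND : N * D.radius ≤ 1 / (12 * d₁) * S.radius := by
    calc N * D.radius ≤ N * (S.radius / (12 * d₁ * N)) := by gcongr
      _ = 1 / (12 * d₁) * S.radius := by field_simp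
  have hρd : ρ₀ / (100 * d₁) ≤ ρ / (100 * d₁) := by gcongr
  have hρd0 : 0 ≤ ρ / d₁ := by positivity
  have hρeq : ρ / (100 * d₁) = ρ / d₁ / 100 := by field_simp
  have hρd1 : ρ / d₁ ≤ ρ := div_le_self hρ0 hd₁1
  have hκd : 12 * d * (1 / (12 * d₁)) ≤ 1 := by
    rw [mul_one_div, div_le_one (by positivity)]; gcongr
  -- the almost-periods
  set κ : ℝ := 2 * c / (B.rank : ℝ) with hκdef
  have hκ0 : 0 ≤ κ := by positivity
  have hκ : 12 * (B.rank : ℝ) * κ ≤ 1 / 40 := by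
    -- In rank `0`, division by zero gives `κ = 0`, and every Bohr set with the characters of `B` is
    -- all of `G`.
    rcases eq_or_ne (B.rank : ℝ) 0 with h | h
    · rw [h]; norm_num
    · have : 12 * (B.rank : ℝ) * κ = 24 * c := by rw [hκdef]; field_simp; ring
      linarith
  have hcκ : c / (B.rank : ℝ) * B.radius + c / (B.rank : ℝ) * B.radius = κ * B.radius := by
    rw [hκdef]; ring
  have hcκ0 : 0 ≤ c / (B.rank : ℝ) * B.radius := mul_nonneg (by positivity) B.radius_nonneg
  have hEB : E ⊆ bohrFinset B.chars (κ * B.radius) := fun e he =>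
    bohrFinset_mono subset_rfl (by linarith) (hBB' (hE he))
  set P := bohrFinset B.chars ((1 + κ) * B.radius) with hP
  set Q := bohrFinset B'.chars ((1 + 1 / (12 * d₁)) * ρ) with hQ
  have hQrad : (1 + 1 / (12 * d₁)) * ρ = ρ + ρ / d₁ / 12 := by field_simp
  have hQcard : (Q.card : ℝ) ≤ 2 / α * E.card := by
    have h1 := hB'.card_le (κ := 1 / (12 * d₁)) (by positivity) hκd
      (r := (1 + 1 / (12 * d₁)) * ρ) le_rfl
    calc (Q.card : ℝ) ≤ 2 * B'.toFinset.card := by nlinarith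
      _ = 2 / α * (α * B'.toFinset.card) := by field_simp
      _ ≤ _ := by gcongr
  have hθ1 : (1 : ℝ) / (100 * k) ≤ 1 := by rw [div_le_one (by positivity)]; linarith
  obtain ⟨X, hXS, hXcard, hperiod⟩ := exists_almostPeriods (A := A) (E := E) (S := S.toFinset)
    (P := P) (W := Q) hEne ⟨0, zero_mem_bohrFinset (mul_nonneg (by linarith) B.radius_nonneg)⟩ (by
      intro x hx
      obtain ⟨a, e, ha, he, rfl⟩ := conv_ne_zero hx
      exact bohrFinset_mono subset_rfl (by linarith) (add_mem_bohrFinset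
        (hA (mem_of_indicatorFn_ne_zero ha)) (hEB (mem_of_muFn_ne_zero he)))) (by
      intro e he s hs
      have h1 : s ∈ bohrFinset B'.chars S.radius := by rw [← hSchars]; exact hs
      exact bohrFinset_mono subset_rfl (by rw [hQrad]; linarith)
        (add_mem_bohrFinset (hE he) h1))
    hQcard ⟨0, zero_mem_bohrFinset hS0⟩ hα0 (θ := 1 / (100 * k : ℝ)) (by positivity) hθ1 hp0 hm
  have hScard0 : (0 : ℝ) < S.toFinset.card := by exact_mod_cast card_bohrFinset_pos hS0
  have hXne : X.Nonempty := by
    rw [nonempty_iff_ne_empty]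
    rintro rfl
    rw [card_empty, Nat.cast_zero, mul_zero] at hXcard
    linarith
  have hX0 : (0 : ℝ) < X.card := by exact_mod_cast hXne.card_pos
  -- the annihilator of the spectrum
  set δ : ℝ := α ^ 2 / (19200 * d₁) with hδ
  have hδ0 : 0 ≤ δ := by positivity
  -- As `19200 = 48 · 400`, the term `48 d δ` is at most `α²/400`, half of the error `α²/200`
  -- allowed below.
  have hdδ : d * δ ≤ α ^ 2 / 19200 := by
    calc d * δ = d / d₁ * (α ^ 2 / 19200) := by rw [hδ]; field_simp
      _ ≤ 1 * (α ^ 2 / 19200) := by gcongr; rwa [div_le_one hd₁0]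
      _ = α ^ 2 / 19200 := one_mul _
  have hα2 : α ^ 2 ≤ 1 := pow_le_one₀ hα0.le hα1
  have hδ1 : δ ≤ α ^ 2 / 19200 := by
    rw [hδ]; gcongr; linarith
  obtain ⟨Λ, hΛcard, hΛ⟩ := exists_annihilator hSreg hDreg hDchars (N := N)
    (κ := 1 / (12 * d₁)) (δ := δ) (by positivity) (by rw [hSrank]; exact hκd) hND hδ0
    (by rw [hSrank]; linarith) hXne hXS (by
      refine lt_of_le_of_lt ?_ hN
      refine mul_le_mul_of_nonneg_left (Real.log_le_log (by positivity) ?_) (by norm_num)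
      have h1 : (S.toFinset.card : ℝ) / X.card ≤ 2 * (2 / α) ^ m := by
        rw [div_le_iff₀ hX0]; exact hXcard
      linarith)
  obtain ⟨T, hTreg, hTchars, hTlow, hTup⟩ := exists_isRegular (B'.chars ∪ Λ)
    (ρ := δ * D.radius) (by positivity)
  have hT0 : 0 ≤ T.radius := T.radius_nonneg
  have hDS : D.radius ≤ S.radius := by
    refine hDup.trans (div_le_self hS0 ?_)
    calc (1 : ℝ) = 1 * 1 := by norm_num
      _ ≤ 12 * d₁ * N := by gcongr; linarith
  have hTS : T.radius ≤ S.radius := by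
    refine hTup.trans ((mul_le_of_le_one_left hD0 ?_).trans hDS)
    linarith
  have hTsub : T.toFinset ⊆ bohrFinset B'.chars T.radius :=
    bohrFinset_mono (hTchars ▸ subset_union_left) le_rfl
  have hTB' : T.toFinset ⊆ B'.toFinset :=
    hTsub.trans (bohrFinset_mono subset_rfl (by linarith))
  by_cases hinc : ∃ x, 3 / 2 * α ≤ conv (indicatorFn A) (muFn T.toFinset) x
  · right
    refine ⟨T, hTreg, ⟨hTchars ▸ subset_union_left, by linarith⟩, ?_, ?_, hinc⟩
    · rw [BohrSet.rank, hTchars]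
      exact (card_union_le _ _).trans (Nat.add_le_add_left hΛcard _)
    · refine le_trans ?_ hTlow
      calc α ^ 2 * ρ₀ / (10 ^ 8 * 2 ^ 48 * k * N * d₁ ^ 3)
          ≤ α ^ 2 * ρ₀ / (19200 * 1200 * 2 ^ 48 * k * N * d₁ ^ 3) := by gcongr; norm_num
        _ = δ * (ρ₀ / (100 * d₁ * k) / 2 ^ 16 / (12 * d₁ * N) / 2 ^ 16) / 2 ^ 16 := by
            rw [hδ]; field_simp; ring
        _ ≤ δ * (S.radius / (12 * d₁ * N) / 2 ^ 16) / 2 ^ 16 := by gcongr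
        _ ≤ δ * D.radius / 2 ^ 16 := by gcongr
  · left
    push Not at hinc
    have hXB' : X ⊆ bohrFinset B'.chars S.radius := by rw [← hSchars]; exact hXS
    refine le_sum_conv_of_forall_le (T := T) (X := X) (κ := κ) (θ := 1 / (100 * k : ℝ)) (p := p)
      (k := k) hB hA hEne hXne hα0 hαA hκ0 hκ hp0 hp (le_of_eq (by field_simp)) ?_ ?_ hperiod ?_
      fun x => (hinc x).le
    · exact fun t ht => bohrFinset_mono subset_rfl (by linarith) (hBB' (hTB' ht))
    · intro y hy
      obtain ⟨e, he, z, hz, rfl⟩ := smoothKernel_support hXB' k hy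
      have hz' : z ∈ B'.toFinset := bohrFinset_mono subset_rfl (by linarith) hz
      have := add_mem_bohrFinset (hBB' (hE he)) (hBB' hz')
      rwa [hcκ] at this
    · intro x t ht
      have hsup : ∀ y, smoothKernel X E k y ≠ 0 →
          y ∈ bohrFinset B'.chars (ρ + 2 * k * S.radius) := by
        intro y hy
        obtain ⟨e, he, z, hz, rfl⟩ := smoothKernel_support hXB' k hy
        exact add_mem_bohrFinset (hE he) hz
      -- On the large spectrum `γ t` is close to `1`; elsewhere the power `2k` of the coefficient is
      -- small and `|γ t - 1| ≤ 2` suffices.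
      have hη : ∀ γ : AddChar G ℂ, ‖ft (muFn X) γ‖ ^ (2 * k) * ‖γ t - 1‖ ≤ α ^ 2 / 200 := by
        intro γ
        have hle1 := norm_ft_le_one (isProb_muFn hXne) γ
        rcases le_or_gt (1 / 2) ‖ft (muFn X) γ‖ with h | h
        · have h1 := hΛ t (by
            rw [hSchars]
            exact bohrFinset_mono subset_rfl hTup (hTsub ht)) γ h
          have h2 : ∑ χ ∈ Λ, ‖χ t - 1‖ ≤ N * (δ * D.radius) := by
            calc ∑ χ ∈ Λ, ‖χ t - 1‖ ≤ ∑ χ ∈ Λ, δ * D.radius := by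
                  refine sum_le_sum fun χ hχ => ?_
                  exact (mem_bohrFinset.1 ht χ (hTchars ▸ mem_union_right _ hχ)).trans hTup
              _ = Λ.card * (δ * D.radius) := by rw [sum_const, nsmul_eq_mul]
              _ ≤ _ := by gcongr
          have h3 : N * (δ * D.radius) ≤ α ^ 2 / 19200 := by
            have h4 : N * D.radius ≤ 1 := by
              refine hND.trans ?_
              have h5 : S.radius ≤ 2 := by
                have h6 : ρ₀ / (100 * d₁) ≤ ρ₀ := div_le_self hρ₀0 (by linarith)
                have h7 : ρ₀ ≤ 2 := min_le_right _ _
                linarith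
              have h8 : 1 / (12 * d₁) ≤ 1 / 12 := by
                gcongr; linarith
              calc 1 / (12 * d₁) * S.radius ≤ 1 / 12 * 2 := by gcongr
                _ ≤ 1 := by norm_num
            calc N * (δ * D.radius) = δ * (N * D.radius) := by ring
              _ ≤ δ * 1 := by gcongr
              _ ≤ _ := by linarith
          rw [hSrank] at h1
          calc ‖ft (muFn X) γ‖ ^ (2 * k) * ‖γ t - 1‖ ≤ 1 * ‖γ t - 1‖ := by
                gcongr
                exact pow_le_one₀ (norm_nonneg _) hle1
            _ ≤ α ^ 2 / 200 := by rw [one_mul]; linarith [sq_nonneg α]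
        · have h1 : ‖γ t - 1‖ ≤ 2 := by
            refine (norm_sub_le _ _).trans ?_
            rw [AddChar.norm_apply, norm_one]; norm_num
          calc ‖ft (muFn X) γ‖ ^ (2 * k) * ‖γ t - 1‖ ≤ (1 / 2) ^ (2 * k) * 2 := by gcongr
            _ = 2 * (1 / 4) ^ k := by rw [pow_mul]; norm_num; ring
            _ ≤ _ := hk
      refine (abs_conv_smoothKernel_translate_sub_le (Q := Q) (K := 2 / α) (η := α ^ 2 / 200) hEne
        (fun y hy => bohrFinset_mono subset_rfl (by rw [hQrad]; linarith) (hsup y hy))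
        (fun y hy => bohrFinset_mono subset_rfl (by rw [hQrad]; linarith)
          (add_mem_bohrFinset (hsup y hy) (hTsub ht)))
        (by positivity) (by positivity) hQcard hη x).trans ?_
      calc Real.sqrt (2 / α) * (α ^ 2 / 200) ≤ 2 / α * (α ^ 2 / 200) := by
            gcongr
            exact Real.sqrt_le_iff.2 ⟨by positivity, le_self_pow₀ h2α (by norm_num)⟩
        _ = α / 100 := by field_simp; norm_num

end Main

end

/-! ### The theorem with explicit constants. -/

theorem mainTheorem4 :
    ∃ c : ℝ, 0 < c ∧ ∃ C : ℝ, 0 < C ∧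
      ∀ (G : Type*) [AddCommGroup G] [Fintype G], Odd (Fintype.card G) →
      ∀ (B B' : BohrSet G), B.IsRegular → B'.IsRegular → B'.IsSubBohr B.two →
        B'.toFinset ⊆ B.scaled (c / (B.rank : ℝ)) →
      ∀ (α : ℝ), 0 < α →
      ∀ (A A' : Finset G), A ⊆ B.toFinset → twoDilate A' ⊆ B'.toFinset →
        α ≤ relDensity A B.toFinset → α ≤ relDensity (twoDilate A') B'.toFinset →
        α / 4 * (A.card : ℝ) * (A'.card : ℝ) ≤ (threeAPCount A A' A : ℝ) ∨
        ∃ T : BohrSet G, T.IsRegular ∧ T.IsSubBohr B' ∧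
          (T.rank : ℝ) ≤ (B'.rank : ℝ) + C * α⁻¹ * Real.log (2 / α) ^ 4 ∧
          c * min B'.radius 2 * α ^ (C * Real.log (2 / α)) / max (B'.rank : ℝ) 1 ^ 3
            ≤ T.radius ∧
          3 / 2 * α ≤ supNorm (conv (indicatorFn A) (muFn T.toFinset)) := by
  classical
  refine ⟨1 / (10 ^ 8 * 2 ^ 48 * (16 * 10 ^ 10)), by positivity, 5 * 10 ^ 8, by norm_num, ?_⟩
  intro G _ _ hG B B' hB hB' _ hBB' α hα0 A A' hA hA' hαA hαA'
  have hB0 : (0 : ℝ) < B.toFinset.card := by exact_mod_cast card_bohrFinset_pos B.radius_nonneg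
  have hB'0 : (0 : ℝ) < B'.toFinset.card := by exact_mod_cast card_bohrFinset_pos B'.radius_nonneg
  have hα1 : α ≤ 1 := by
    refine hαA.trans ?_
    rw [relDensity, div_le_one hB0]
    exact_mod_cast Finset.card_le_card hA
  rw [relDensity, le_div_iff₀ hB0] at hαA
  rw [relDensity, le_div_iff₀ hB'0] at hαA'
  have hA'ne : A'.Nonempty := by
    rw [Finset.nonempty_iff_ne_empty]
    rintro rfl
    simp only [twoDilate, Finset.image_empty, Finset.card_empty, Nat.cast_zero] at hαA'
    linarith [mul_pos hα0 hB'0]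
  have hEimage : A'.image (fun y : G => -(2 • y)) = (twoDilate A').image fun y => -y := by
    rw [twoDilate, Finset.image_image]; rfl
  have hEcard : (A'.image fun y : G => -(2 • y)).card = (twoDilate A').card := by
    rw [hEimage, Finset.card_image_of_injective _ neg_injective]
  obtain ⟨p, k, m, N, hp0, hp, hk0, hk, hm, hN, hkle, hNle⟩ := exists_parameters hα0 hα1
  rcases count_or_increment hB hB' (by positivity) (by norm_num) hBB' hα0 hα1 hA
    (E := A'.image fun y : G => -(2 • y)) (by
      rw [hEimage]
      intro y hy
      obtain ⟨z, hz, rfl⟩ := Finset.mem_image.1 hy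
      exact neg_mem_bohrFinset (hA' hz)) hαA (by rw [hEcard]; exact hαA') hp0 hp hk0 hk hm hN
    with h | ⟨T, hTreg, hTsub, hTrank, hTrad, x, hx⟩
  · left
    rw [threeAPCount_eq hG hA'ne, mul_comm]
    gcongr
  · right
    refine ⟨T, hTreg, hTsub, ?_, ?_, ?_⟩
    · have : (T.rank : ℝ) ≤ B'.rank + N := by exact_mod_cast hTrank
      linarith
    · refine le_trans ?_ hTrad
      set l := Real.log (2 / α) with hl
      have hl69 : (0.69 : ℝ) ≤ l := by
        have : Real.log 2 ≤ l :=
          Real.log_le_log (by norm_num) (by rw [le_div_iff₀ hα0]; linarith)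
        linarith [Real.log_two_gt_d9]
      have hlα : l ≤ 2 / α := Real.log_le_self (by positivity)
      have hk1 : (0 : ℝ) < k := by exact_mod_cast hk0
      have hN0 : (0 : ℝ) < N := by
        refine lt_of_le_of_lt (mul_nonneg (by norm_num) (Real.log_nonneg ?_)) hN
        have : (1 : ℝ) ≤ (2 / α) ^ m := one_le_pow₀ (by rw [le_div_iff₀ hα0]; linarith)
        linarith
      -- Bounding `l` by `2/α` makes `k N` at most a constant times `α⁻⁶`. With the factor `α²`
      -- already in the radius this needs `α^8`, which dominates `α^(C l)` because `C l ≥ 8`.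
      have hkN : (k : ℝ) * N * α ^ 6 ≤ 16 * 10 ^ 10 := by
        calc (k : ℝ) * N * α ^ 6 ≤ (10 * l) * (5 * 10 ^ 8 * α⁻¹ * l ^ 4) * α ^ 6 := by gcongr
          _ = 5 * 10 ^ 9 * l ^ 5 * α ^ 5 := by field_simp
          _ ≤ 5 * 10 ^ 9 * (2 / α) ^ 5 * α ^ 5 := by gcongr
          _ = 16 * 10 ^ 10 := by field_simp; norm_num
      have hpow : α ^ (5 * 10 ^ 8 * l) ≤ α ^ 8 := by
        rw [← Real.rpow_natCast α 8]
        refine Real.rpow_le_rpow_of_exponent_ge hα0 hα1 ?_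
        push_cast
        linarith
      have hρ : 0 ≤ min B'.radius 2 := le_min B'.radius_nonneg (by norm_num)
      set d₁ := max (B'.rank : ℝ) 1 with hd₁
      have hd₁0 : 0 < d₁ := lt_of_lt_of_le one_pos (le_max_right _ _)
      calc 1 / (10 ^ 8 * 2 ^ 48 * (16 * 10 ^ 10)) * min B'.radius 2 * α ^ (5 * 10 ^ 8 * l) / d₁ ^ 3
          ≤ 1 / (10 ^ 8 * 2 ^ 48 * (k * N * α ^ 6)) * min B'.radius 2 * α ^ 8 / d₁ ^ 3 := by
            gcongr
        _ = α ^ 2 * min B'.radius 2 / (10 ^ 8 * 2 ^ 48 * k * N * d₁ ^ 3) := by field_simp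
    · refine hx.trans ((le_abs_self _).trans ?_)
      exact le_ciSup (f := fun x => |conv (indicatorFn A) (muFn T.toFinset) x|)
        (Set.finite_range _).bddAbove x
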